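/- Let $n\geqslant 3$ and let $b>0$, $\nu>0$, $\kappa>0$, $\gamma\in(1,5/3]$ be real parameters; put $\delta:=b\nu+(\gamma-1)\kappa$. Consider the Cauchy problem for the linear Blackstock model $$\begin{cases}(\partial_t-\kappa\Delta)(\psi_{tt}-\Delta\psi-\delta\Delta\psi_t)+\kappa(\gamma-1)(b\nu-\kappa)\Delta^2\psi_t=0,& x\in\mathbb{R}^n,\ t>0,\\ \psi(0,x)=\psi_0(x),\ \psi_t(0,x)=\psi_1(x),\ \psi_{tt}(0,x)=\psi_2(x),& x\in\mathbb{R}^n.\end{cases}$$ A solution is a function $\psi\in\mathcal{C}([0,\infty),L^2(\mathbb{R}^n))$ such that for every Schwartz function $\varphi$ the map $t\mapsto\int_{\mathbb{R}^n}\psi(t,x)\varphi(x)\,\mathrm{d}x$ is three times continuously differentiable on $[0,\infty)$ (one-sided at $t=0$), and such that the equation for $t>0$ and the initial conditions at $t=0$ hold in the sense of tempered distributions on $\mathbb{R}^n$. Functions may be complex-valued. For $f\in L^1(\mathbb{R}^n)$ let $P_f:=\int_{\mathbb{R}^n}f(x)\,\mathrm{d}x$ and $\|f\|_{L^{1,1}}:=\int_{\mathbb{R}^n}(1+|x|)|f(x)|\,\mathrm{d}x$,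 let $L^{1,1}$ be the set of $f\in L^1$ with $\|f\|_{L^{1,1}}<\infty$, and let $\|f\|_{L^2\cap L^{1,1}}:=\|f\|_{L^2}+\|f\|_{L^{1,1}}$. Define, for $n\geqslant 3$ and $t\geqslant0$, $$\mathcal{D}_n(1+t):=(1+t)^{\frac12-\frac n4},\qquad \widetilde{\mathcal{D}}_n(1+t):=\begin{cases}(1+t)^{\frac12}&\text{if } n=3,\\ (\ln(\mathrm{e}+t))^{\frac12}&\text{if } n=4,\\ (1+t)^{1-\frac n4}&\text{if } n\geqslant5.\end{cases}$$ Then there is a constant $C>0$, depending only on $n,b,\nu,\kappa,\gamma$, such that for all initial data $\psi_0,\psi_1,\psi_2\in L^2\cap L^{1,1}$ the Cauchy problem has a unique solution $\psi$, and it fulfills for all $t\geqslant0$ $$\begin{aligned}\|\psi(t,\cdot)\|_{L^2}\leqslant C\Big(&(1+t)^{-\frac{n+2}{4}}\|\psi_0\|_{L^2\cap L^{1,1}}+(1+t)^{-\frac n4}\|\psi_1\|_{L^2\cap L^{1,1}}+\mathcal{D}_n(1+t)\|\psi_2\|_{L^2\cap L^{1,1}}\\&+(1+t)^{-\frac n4}|P_{\psi_0}|+\mathcal{D}_n(1+t)|P_{\psi_1}|+\widetilde{\mathcal{D}}_n(1+t)|P_{\psi_2}|\Big).\end{aligned}$$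 -/

import Mathlib

open MeasureTheory
open scoped SchwartzMap Laplacian

namespace Blackstock

/-- The space `ℝⁿ` with its Euclidean norm and Lebesgue measure. -/
abbrev Rn (n : ℕ) : Type := EuclideanSpace ℝ (Fin n)

/-- `f ∈ L² ∩ L^{1,1}`: square integrable, integrable, with `∫ (1 + |x|) |f(x)| dx < ∞`. -/
structure MemData {n : ℕ} (f : Rn n → ℂ) : Prop where
  memL2 : MemLp f 2 volume
  integrable : Integrable f volume
  weighted : Integrable (fun x => (1 + ‖x‖) * ‖f x‖) volume

/-- `‖f‖_{L²}` as a real number. -/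
noncomputable def normL2 {n : ℕ} (f : Rn n → ℂ) : ℝ :=
  (eLpNorm f 2 volume).toReal

/-- `‖f‖_{L^{1,1}} = ∫ (1 + |x|) |f(x)| dx`. -/
noncomputable def normL11 {n : ℕ} (f : Rn n → ℂ) : ℝ :=
  ∫ x, (1 + ‖x‖) * ‖f x‖

/-- `‖f‖_{L² ∩ L^{1,1}} = ‖f‖_{L²} + ‖f‖_{L^{1,1}}`. -/
noncomputable def dataNorm {n : ℕ} (f : Rn n → ℂ) : ℝ :=
  normL2 f + normL11 f

/-- The mean `P_f = ∫ f(x) dx`. -/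
noncomputable def mean {n : ℕ} (f : Rn n → ℂ) : ℂ :=
  ∫ x, f x

/-- The weight `𝒟_n(1 + t)`, as a function of `t`. -/
noncomputable def weightD (n : ℕ) (t : ℝ) : ℝ :=
  if n ≤ 1 then (1 + t) ^ (1 / 2 : ℝ)
  else if n = 2 then Real.log (Real.exp 1 + t) ^ (1 / 2 : ℝ)
  else (1 + t) ^ (1 / 2 - (n : ℝ) / 4)

/-- The weight `𝒟̃_n(1 + t)`, as a function of `t`. -/
noncomputable def weightDTilde (n : ℕ) (t : ℝ) : ℝ :=
  if n ≤ 3 then (1 + t) ^ (2 - (n : ℝ) / 2)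
  else if n = 4 then Real.log (Real.exp 1 + t) ^ (1 / 2 : ℝ)
  else (1 + t) ^ (1 - (n : ℝ) / 4)

/-- The pairing `⟨u, φ⟩ = ∫ u(x) φ(x) dx` of `u ∈ L²` with a Schwartz test function. -/
noncomputable def pairing {n : ℕ} (u : Lp ℂ 2 (volume : Measure (Rn n)))
    (φ : 𝓢(Rn n, ℂ)) : ℂ :=
  ∫ x, u x * φ x

/-- The time derivative of order `k` at time `t ≥ 0` (one-sided at `t = 0`) of `⟨ψ(t), φ⟩`,
that is, the value at `φ` of `∂_t^k ψ(t)` as a tempered distribution in space. -/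
noncomputable def dtPairing {n : ℕ} (k : ℕ) (ψ : ℝ → Lp ℂ 2 (volume : Measure (Rn n)))
    (φ : 𝓢(Rn n, ℂ)) (t : ℝ) : ℂ :=
  iteratedDerivWithin k (fun s => pairing (ψ s) φ) (Set.Ici 0) t

/-- The modified diffusivity of sound `δ = b ν + (γ - 1) κ`. -/
def soundDiffusivity (b ν κ γ : ℝ) : ℝ := b * ν + (γ - 1) * κ

/-- `ψ ∈ C([0,∞), L²)` solves the Cauchy problem of the linear Blackstock model
`(∂_t - κΔ)(ψ_tt - Δψ - δΔψ_t) + κ(γ-1)(bν-κ)Δ²ψ_t = 0` for `t > 0`, with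
`ψ(0) = ψ₀`, `ψ_t(0) = ψ₁`, `ψ_tt(0) = ψ₂`.
The function `ψ` is three times continuously differentiable in time as a map into the tempered
distributions, and the equation and the initial conditions hold in the tempered distributions;
spatial operators are moved to the test function and the product of operators is expanded:
`ψ_ttt - (δ+κ)Δψ_tt - Δψ_t + (κδ + κ(γ-1)(bν-κ))Δ²ψ_t + κΔ²ψ = 0`.
Values of `ψ` at negative times are irrelevant. -/
structure IsSolution {n : ℕ} (b ν κ γ : ℝ) (ψ₀ ψ₁ ψ₂ : Rn n → ℂ)
    (ψ : ℝ → Lp ℂ 2 (volume : Measure (Rn n))) : Prop where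
  continuousOn : ContinuousOn ψ (Set.Ici 0)
  contDiffOn : ∀ φ : 𝓢(Rn n, ℂ), ContDiffOn ℝ 3 (fun t => pairing (ψ t) φ) (Set.Ici 0)
  equation : ∀ φ : 𝓢(Rn n, ℂ), ∀ t : ℝ, 0 < t →
    dtPairing 3 ψ φ t
      - ((soundDiffusivity b ν κ γ + κ : ℝ) : ℂ) * dtPairing 2 ψ (Δ φ) t
      - dtPairing 1 ψ (Δ φ) t
      + ((κ * soundDiffusivity b ν κ γ + κ * (γ - 1) * (b * ν - κ) : ℝ) : ℂ)
          * dtPairing 1 ψ (Δ (Δ φ)) t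
      + (κ : ℂ) * dtPairing 0 ψ (Δ (Δ φ)) t = 0
  init_zero : ∀ φ : 𝓢(Rn n, ℂ), dtPairing 0 ψ φ 0 = ∫ x, ψ₀ x * φ x
  init_one : ∀ φ : 𝓢(Rn n, ℂ), dtPairing 1 ψ φ 0 = ∫ x, ψ₁ x * φ x
  init_two : ∀ φ : 𝓢(Rn n, ℂ), dtPairing 2 ψ φ 0 = ∫ x, ψ₂ x * φ x

end Blackstock

/-! After a Fourier transform in space, with r = 2π|ξ| and a = bν, the equation becomes a third
order ODE in time, u''' + (a + γκ) r² u'' + (r² + γκa r⁴) u' + κ r⁴ u = 0. The theorem reduces to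
bounds, in r and t, on its three fundamental solutions K_j, together with integrals of these bounds
over ξ.

The bounds avoid the characteristic roots. With V = u'/r and Θ = (u'' + a r² u' + (r²/γ) u)/r², the
triple (u, V, Θ) satisfies a first order system of the type of linearized compressible, viscous and
heat conducting flow: a skew part after weighting by 1, γ, γ²/(γ-1), plus damping of V and Θ only. A
small multiple of the cross term u V transfers damping to u, in the manner of Kawashima, so the
energy decays like exp(-c r² t/(1 + r²)) uniformly in r (`energy_decay`). The initial energy of K_j
is at most a constant times (1 + r⁻²)^j. Hence K_j² is bounded by r^(-2j) exp(-c(1+t)r²) up to a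
constant for r ≤ 1, and decays exponentially in t for r ≥ 1.

For r ≤ 1 the transform of a datum is its mean plus an error r times the weighted norm. The mean
thus meets K_j, and the norm meets r K_j, which gains a factor (1+t)^(-1/2). All these are Gaussian
moments except K_2 in dimensions three and four, where r⁻⁴ is not integrable at the origin. There
the second bound |K_2| ≤ C t/r (`kernel_two_le`) intervenes, and the resulting integrals produce the
square root and the logarithm. `normL2_fourierSol_le` assembles the estimate through Plancherel.

Existence: the inverse transform of Σ K_j ψ̂_j is a solution, by differentiation under the integral
against Schwartz functions (`isSolution_solution`). Uniqueness: for test functions with compactly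
supported transform, iterated Laplacians grow only geometrically, so integrating the equation in
time repeatedly forces the difference to vanish (`IsSolution.eq`). -/

namespace Blackstock

open scoped FourierTransform Real Topology
open Filter

/-! ### Energy decay at a fixed frequency -/

/-- The energy of the symmetrized system: for `u''' + (a + γκ) r² u'' + (r² + γκa r⁴) u' + κ r⁴ u = 0`
it is dissipated. -/
noncomputable def energy (a γ r x y z : ℝ) : ℝ :=
  x ^ 2 + γ * (y / r) ^ 2 + γ ^ 2 / (γ - 1) * ((z + a * r ^ 2 * y + r ^ 2 / γ * x) / r ^ 2) ^ 2

/-- The compensated energy. -/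
noncomputable def compensated (a γ ε r x y z : ℝ) : ℝ :=
  energy a γ r x y z + ε * (r / (1 + r ^ 2)) * (x * (y / r))

/-- The left side is the time derivative of the compensated energy. Its only damping of ρ is -ρ²/γ.
Young's inequality spends a quarter of that on each of the cross terms ρΘ and rρV; the V and Θ
squares this creates cost at most half of the existing dissipation, because q = r²/(1+r²) satisfies
both q ≤ r² and q r² ≤ r². -/
lemma compensated_dissipation (a κ γ ε r ρ V Θ : ℝ) (ha : 0 < a) (hκ : 0 < κ) (hγ : 1 < γ)
    (hr : 0 < r) (hε : 0 < ε) (h1 : ε * (1 + γ * a ^ 2) ≤ a * γ)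
    (h2 : ε * γ ≤ γ ^ 3 * κ / (γ - 1)) :
    -2 * a * γ * r ^ 2 * V ^ 2 - 2 * (γ ^ 3 * κ / (γ - 1)) * r ^ 2 * Θ ^ 2
      + ε * (r ^ 2 / (1 + r ^ 2)) * (V ^ 2 + ρ * Θ - a * r * ρ * V - ρ ^ 2 / γ)
    ≤ -(r ^ 2 / (1 + r ^ 2)) * (ε / (2 * γ) * ρ ^ 2 + a * γ * V ^ 2
        + γ ^ 3 * κ / (γ - 1) * Θ ^ 2) := by
  set q := r ^ 2 / (1 + r ^ 2) with hq
  set c := γ ^ 3 * κ / (γ - 1) with hc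
  have hc0 : 0 < c := by have : 0 < γ - 1 := by linarith
                         positivity
  have hq0 : 0 ≤ q := by positivity
  have hq1 : q ≤ r ^ 2 := div_le_self (by positivity) (by nlinarith)
  have hq2 : q * (1 + r ^ 2) = r ^ 2 := by rw [hq]; field_simp
  have hq3 : q * r ^ 2 ≤ r ^ 2 := by nlinarith
  have hγ0 : 0 < γ := by linarith
  have e1 : ρ * Θ ≤ ρ ^ 2 / (4 * γ) + γ * Θ ^ 2 := by
    have : ρ ^ 2 / (4 * γ) + γ * Θ ^ 2 - ρ * Θ = (ρ - 2 * γ * Θ) ^ 2 / (4 * γ) := by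
      field_simp; ring
    have : 0 ≤ (ρ - 2 * γ * Θ) ^ 2 / (4 * γ) := by positivity
    linarith
  have e2 : -(a * r * ρ * V) ≤ ρ ^ 2 / (4 * γ) + γ * a ^ 2 * r ^ 2 * V ^ 2 := by
    have : ρ ^ 2 / (4 * γ) + γ * a ^ 2 * r ^ 2 * V ^ 2 + a * r * ρ * V
        = (ρ + 2 * γ * a * r * V) ^ 2 / (4 * γ) := by
      field_simp; ring
    have : 0 ≤ (ρ + 2 * γ * a * r * V) ^ 2 / (4 * γ) := by positivity
    linarith
  have e3 : ρ ^ 2 / γ = ρ ^ 2 / (4 * γ) + ρ ^ 2 / (4 * γ) + ρ ^ 2 / (2 * γ) := by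
    field_simp; ring
  have e4 : ε * q * (V ^ 2 + ρ * Θ - a * r * ρ * V - ρ ^ 2 / γ)
      ≤ ε * q * (V ^ 2 + γ * Θ ^ 2 + γ * a ^ 2 * r ^ 2 * V ^ 2 - ρ ^ 2 / (2 * γ)) := by
    apply mul_le_mul_of_nonneg_left _ (by positivity)
    linarith
  have e5 : ε * q * V ^ 2 + ε * q * (γ * a ^ 2 * r ^ 2 * V ^ 2) ≤ a * γ * r ^ 2 * V ^ 2 := by
    have : ε * q * V ^ 2 + ε * (γ * a ^ 2 * V ^ 2) * (q * r ^ 2)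
        ≤ ε * r ^ 2 * V ^ 2 + ε * (γ * a ^ 2 * V ^ 2) * r ^ 2 := by gcongr
    have h3 := mul_le_mul_of_nonneg_right h1 (show 0 ≤ r ^ 2 * V ^ 2 by positivity)
    linarith
  have e6 : ε * q * (γ * Θ ^ 2) ≤ c * r ^ 2 * Θ ^ 2 := by
    have h3 := mul_le_mul_of_nonneg_right h2 (show 0 ≤ q * Θ ^ 2 by positivity)
    have h4 : c * (q * Θ ^ 2) ≤ c * (r ^ 2 * Θ ^ 2) := by gcongr
    linarith
  have e7 : q * (a * γ * V ^ 2) ≤ r ^ 2 * (a * γ * V ^ 2) := by gcongr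
  have e8 : q * (c * Θ ^ 2) ≤ r ^ 2 * (c * Θ ^ 2) := by gcongr
  have e9 : ε * q * (ρ ^ 2 / (2 * γ)) = q * (ε / (2 * γ) * ρ ^ 2) := by ring
  linarith

/-- The factor r/(1+r²) never exceeds 1/2, so the cross term is a perturbation of at most half the
energy at every frequency. -/
lemma compensated_le_energy (a γ ε r x y z : ℝ) (hγ : 1 < γ) (hε : 0 < ε) (hε1 : ε ≤ 1)
    (hr : 0 < r) :
    energy a γ r x y z / 2 ≤ compensated a γ ε r x y z ∧
      compensated a γ ε r x y z ≤ 3 / 2 * energy a γ r x y z := by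
  have h : r / (1 + r ^ 2) ≤ 1 / 2 := by
    rw [div_le_div_iff₀ (by positivity) (by norm_num)]; nlinarith [sq_nonneg (r - 1)]
  have h0 : 0 ≤ r / (1 + r ^ 2) := by positivity
  have h' : ε * (r / (1 + r ^ 2)) ≤ 1 * (1 / 2) := by gcongr
  have key : |ε * (r / (1 + r ^ 2)) * (x * (y / r))| ≤ energy a γ r x y z / 2 := by
    rw [abs_mul, abs_of_nonneg (by positivity), abs_mul]
    have : ε * (r / (1 + r ^ 2)) * (|x| * |y / r|) ≤ 1 * (1 / 2) * (|x| * |y / r|) := by gcongr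
    have h3 := sq_nonneg (|x| - |y / r|)
    have h4 : 0 ≤ γ ^ 2 / (γ - 1) * ((z + a * r ^ 2 * y + r ^ 2 / γ * x) / r ^ 2) ^ 2 := by
      have : 0 < γ - 1 := by linarith
      positivity
    have h5 : 1 * (y / r) ^ 2 ≤ γ * (y / r) ^ 2 := by gcongr
    have h6 := sq_abs x
    have h7 := sq_abs (y / r)
    unfold energy
    nlinarith [sq_nonneg (y / r), sq_nonneg x]
  have := abs_le.1 key
  unfold compensated
  constructor <;> linarith

/-- Exponential decay of the energy along solutions, with a rate uniform in the frequency. -/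
theorem energy_decay (a κ γ : ℝ) (ha : 0 < a) (hκ : 0 < κ) (hγ : 1 < γ) :
    ∃ c : ℝ, 0 < c ∧ ∀ r : ℝ, 0 < r → ∀ x y z : ℝ → ℝ,
      (∀ t, HasDerivAt x (y t) t) → (∀ t, HasDerivAt y (z t) t) →
      (∀ t, HasDerivAt z (-((a + γ * κ) * r ^ 2) * z t - (r ^ 2 + γ * κ * a * r ^ 4) * y t
        - κ * r ^ 4 * x t) t) →
      ∀ t, 0 ≤ t → energy a γ r (x t) (y t) (z t) ≤
        3 * energy a γ r (x 0) (y 0) (z 0) * Real.exp (-c * (r ^ 2 / (1 + r ^ 2)) * t) := by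
  have hγ0 : 0 < γ := by linarith
  have hγ1 : 0 < γ - 1 := by linarith
  set cΘ := γ ^ 3 * κ / (γ - 1) with hcΘ
  have hcΘ0 : 0 < cΘ := by positivity
  -- Of the three smallness conditions, the first keeps the compensated energy equivalent to the
  -- energy, and the other two let the damping of V and Θ absorb the cross terms.
  obtain ⟨ε, hε, hε1, h1, h2⟩ : ∃ ε : ℝ, 0 < ε ∧ ε ≤ 1 ∧ ε * (1 + γ * a ^ 2) ≤ a * γ ∧
      ε * γ ≤ cΘ := by
    refine ⟨min 1 (min (a * γ / (1 + γ * a ^ 2)) (cΘ / γ)), by positivity, min_le_left _ _, ?_, ?_⟩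
    · rw [← le_div_iff₀ (by positivity)]
      exact (min_le_right _ _).trans (min_le_left _ _)
    · rw [← le_div_iff₀ (by positivity)]
      exact (min_le_right _ _).trans (min_le_right _ _)
  -- The factor 3/2 is the upper equivalence constant between the two energies: the dissipation must
  -- dominate c times the compensated one.
  obtain ⟨c, hc, hc1, hc2, hc3⟩ : ∃ c : ℝ, 0 < c ∧ c * (3 / 2) ≤ ε / (2 * γ) ∧
      c * (3 / 2 * γ) ≤ a * γ ∧ c * (3 / 2 * (γ ^ 2 / (γ - 1))) ≤ cΘ := by
    refine ⟨min (ε / (2 * γ) / (3 / 2)) (min (a * γ / (3 / 2 * γ))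
      (cΘ / (3 / 2 * (γ ^ 2 / (γ - 1))))), by positivity, ?_, ?_, ?_⟩
    · rw [← le_div_iff₀ (by positivity)]
      exact min_le_left _ _
    · rw [← le_div_iff₀ (by positivity)]
      exact (min_le_right _ _).trans (min_le_left _ _)
    · rw [← le_div_iff₀ (by positivity)]
      exact (min_le_right _ _).trans (min_le_right _ _)
  refine ⟨c, hc, fun r hr x y z hx hy hz t ht => ?_⟩
  set q := r ^ 2 / (1 + r ^ 2) with hq
  have hq0 : 0 ≤ q := by positivity
  set L : ℝ → ℝ := fun t => compensated a γ ε r (x t) (y t) (z t) with hL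
  set V : ℝ → ℝ := fun t => y t / r with hV
  set Θ : ℝ → ℝ := fun t => (z t + a * r ^ 2 * y t + r ^ 2 / γ * x t) / r ^ 2 with hΘ
  have dx : ∀ t, HasDerivAt x (r * V t) t := fun t => by
    refine (hx t).congr_deriv ?_; simp only [hV]; field_simp
  have dV : ∀ t, HasDerivAt V (r * Θ t - a * r ^ 2 * V t - r / γ * x t) t := fun t => by
    refine ((hy t).div_const r).congr_deriv ?_
    simp only [hV, hΘ]; field_simp; ring
  have dΘ : ∀ t, HasDerivAt Θ (-(γ * κ * r ^ 2) * Θ t - (γ - 1) / γ * r * V t) t := fun t => by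
    refine ((((hz t).add ((hy t).const_mul (a * r ^ 2))).add
      ((hx t).const_mul (r ^ 2 / γ))).div_const (r ^ 2)).congr_deriv ?_
    simp only [hV, hΘ]; field_simp; ring
  have hLeq : L = fun t => x t ^ 2 + γ * V t ^ 2 + γ ^ 2 / (γ - 1) * Θ t ^ 2
      + ε * (r / (1 + r ^ 2)) * (x t * V t) := by
    ext t; simp [hL, compensated, energy, hV, hΘ]
  have dL : ∀ t, ∃ l, HasDerivAt L l t ∧ l ≤ -c * q * L t := fun t => by
    rw [hLeq]
    refine ⟨_, ((((dx t).pow 2).add (((dV t).pow 2).const_mul γ)).add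
      (((dΘ t).pow 2).const_mul (γ ^ 2 / (γ - 1)))).add
      (((dx t).mul (dV t)).const_mul (ε * (r / (1 + r ^ 2)))), ?_⟩
    have hd := compensated_dissipation a κ γ ε r (x t) (V t) (Θ t) ha hκ hγ hr hε h1 h2
    have hup := (compensated_le_energy a γ ε r (x t) (y t) (z t) hγ hε hε1 hr).2
    have hLt : compensated a γ ε r (x t) (y t) (z t) = L t := rfl
    rw [hLt, hLeq] at hup
    have hen : energy a γ r (x t) (y t) (z t)
      = x t ^ 2 + γ * V t ^ 2 + γ ^ 2 / (γ - 1) * Θ t ^ 2 := rfl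
    rw [hen] at hup
    have hup2 := mul_le_mul_of_nonneg_left hup (show 0 ≤ c * q by positivity)
    have h3 : c * q * (3 / 2 * (x t ^ 2 + γ * V t ^ 2 + γ ^ 2 / (γ - 1) * Θ t ^ 2)) ≤
        q * (ε / (2 * γ) * x t ^ 2 + a * γ * V t ^ 2 + cΘ * Θ t ^ 2) := by
      have e1 := mul_le_mul_of_nonneg_right hc1 (show 0 ≤ q * x t ^ 2 by positivity)
      have e2 := mul_le_mul_of_nonneg_right hc2 (show 0 ≤ q * V t ^ 2 by positivity)
      have e3 := mul_le_mul_of_nonneg_right hc3 (show 0 ≤ q * Θ t ^ 2 by positivity)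
      linarith
    have h4 : ∀ w : ℝ, w = -2 * a * γ * r ^ 2 * V t ^ 2 - 2 * cΘ * r ^ 2 * Θ t ^ 2
        + ε * q * (V t ^ 2 + x t * Θ t - a * r * x t * V t - x t ^ 2 / γ) →
        w ≤ -c * q * (x t ^ 2 + γ * V t ^ 2 + γ ^ 2 / (γ - 1) * Θ t ^ 2
      + ε * (r / (1 + r ^ 2)) * (x t * V t)) := by
      rintro w rfl
      linarith
    -- The remaining identity is where the skew terms cancel: the weights 1, γ, γ²/(γ-1) annihilate
    -- the products uV and VΘ of the plain energy.
    apply h4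
    simp only [hcΘ, hq]
    field_simp
    ring
  have hanti : AntitoneOn (fun t => L t * Real.exp (c * q * t)) (Set.Ici 0) := by
    choose l hl hl' using dL
    have hd : ∀ t, HasDerivAt (fun t => L t * Real.exp (c * q * t))
        (l t * Real.exp (c * q * t) + L t * (Real.exp (c * q * t) * (c * q * 1))) t := fun t =>
      (hl t).mul (((hasDerivAt_id t).const_mul (c * q)).exp)
    apply antitoneOn_of_deriv_nonpos (convex_Ici 0)
    · exact fun t _ => (hd t).continuousAt.continuousWithinAt
    · exact fun t _ => (hd t).differentiableAt.differentiableWithinAt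
    · intro t _
      rw [(hd t).deriv]
      have := mul_le_mul_of_nonneg_right (hl' t) (Real.exp_pos (c * q * t)).le
      linarith
  have h5 := hanti (Set.mem_Ici.2 le_rfl) (Set.mem_Ici.2 ht) ht
  simp only [mul_zero, Real.exp_zero, mul_one] at h5
  have h6 : L t ≤ L 0 * Real.exp (-c * q * t) := by
    have : Real.exp (-c * q * t) = (Real.exp (c * q * t))⁻¹ := by
      rw [← Real.exp_neg]; ring_nf
    rw [this, ← div_eq_mul_inv, le_div_iff₀ (Real.exp_pos _)]
    exact h5
  have h7 := (compensated_le_energy a γ ε r (x t) (y t) (z t) hγ hε hε1 hr).1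
  have h8 := (compensated_le_energy a γ ε r (x 0) (y 0) (z 0) hγ hε hε1 hr).2
  have h9 := mul_le_mul_of_nonneg_right h8 (Real.exp_pos (-c * q * t)).le
  have : L t = compensated a γ ε r (x t) (y t) (z t) := rfl
  have : L 0 = compensated a γ ε r (x 0) (y 0) (z 0) := rfl
  linarith

/-! ### The fundamental solutions as matrix exponentials -/

/-- The generator of `u''' + (a + γκ) r² u'' + (r² + γκa r⁴) u' + κ r⁴ u = 0` as a first order
system for `(u, u', u'')`. -/
noncomputable def generator (a κ γ r : ℝ) : (Fin 3 → ℝ) →L[ℝ] (Fin 3 → ℝ) :=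
  (ContinuousLinearMap.proj (R := ℝ) (φ := fun _ : Fin 3 => ℝ) 1).smulRight (Pi.single 0 1)
    + (ContinuousLinearMap.proj (R := ℝ) (φ := fun _ : Fin 3 => ℝ) 2).smulRight
        (Pi.single 1 1 - ((a + γ * κ) * r ^ 2) • Pi.single 2 1)
    - (ContinuousLinearMap.proj (R := ℝ) (φ := fun _ : Fin 3 => ℝ) 1).smulRight
        ((r ^ 2 + γ * κ * a * r ^ 4) • Pi.single 2 1)
    - (ContinuousLinearMap.proj (R := ℝ) (φ := fun _ : Fin 3 => ℝ) 0).smulRight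
        ((κ * r ^ 4) • Pi.single 2 1)

lemma generator_zero (a κ γ r : ℝ) (x : Fin 3 → ℝ) : generator a κ γ r x 0 = x 1 := by
  simp [generator]

lemma generator_one (a κ γ r : ℝ) (x : Fin 3 → ℝ) : generator a κ γ r x 1 = x 2 := by
  simp [generator]

lemma generator_two (a κ γ r : ℝ) (x : Fin 3 → ℝ) : generator a κ γ r x 2 =
    -((a + γ * κ) * r ^ 2) * x 2 - (r ^ 2 + γ * κ * a * r ^ 4) * x 1 - κ * r ^ 4 * x 0 := by
  simp [generator]; ring

lemma continuous_generator (a κ γ : ℝ) : Continuous (generator a κ γ) := by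
  have h : ∀ (i : Fin 3) (v : ℝ → Fin 3 → ℝ), Continuous v → Continuous fun r =>
      (ContinuousLinearMap.proj (R := ℝ) (φ := fun _ : Fin 3 => ℝ) i).smulRight (v r) := by
    intro i v hv
    exact (ContinuousLinearMap.smulRightL ℝ (Fin 3 → ℝ) (Fin 3 → ℝ)
      (ContinuousLinearMap.proj i)).continuous.comp hv
  unfold generator
  refine ((continuous_const.add (h _ _ ?_)).sub (h _ _ ?_)).sub (h _ _ ?_) <;> fun_prop

/-- The `k`-th time derivative at time `t` of the solution whose `j`-th initial derivative is one,
the others being zero. -/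
noncomputable def kernel (a κ γ : ℝ) (k : ℕ) (j : Fin 3) (t r : ℝ) : ℝ :=
  ((generator a κ γ r ^ k) (NormedSpace.exp (t • generator a κ γ r) (Pi.single j 1))) 0

lemma hasDerivAt_kernel (a κ γ : ℝ) (k : ℕ) (j : Fin 3) (t r : ℝ) :
    HasDerivAt (fun t => kernel a κ γ k j t r) (kernel a κ γ (k + 1) j t r) t := by
  have h := hasDerivAt_exp_smul_const' (𝕂 := ℝ) (generator a κ γ r) t
  have h2 := h.clm_apply (hasDerivAt_const t (Pi.single j (1 : ℝ) : Fin 3 → ℝ))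
  have h3 := (((ContinuousLinearMap.proj (R := ℝ) (φ := fun _ : Fin 3 => ℝ) 0).comp
    (generator a κ γ r ^ k)).hasFDerivAt).comp_hasDerivAt t h2
  refine h3.congr_deriv ?_
  simp [kernel, pow_succ]

lemma continuous_kernel (a κ γ : ℝ) (k : ℕ) (j : Fin 3) :
    Continuous fun p : ℝ × ℝ => kernel a κ γ k j p.1 p.2 := by
  have h := continuous_generator a κ γ
  have h2 : Continuous fun p : ℝ × ℝ => NormedSpace.exp (p.1 • generator a κ γ p.2) :=
    letI : NormedAlgebra ℚ ((Fin 3 → ℝ) →L[ℝ] (Fin 3 → ℝ)) := NormedAlgebra.restrictScalars ℚ ℝ _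
    NormedSpace.exp_continuous.comp (by fun_prop)
  unfold kernel
  exact (continuous_apply 0).comp
    (((h.comp continuous_snd).pow k).clm_apply (h2.clm_apply continuous_const))

lemma kernel_three (a κ γ : ℝ) (j : Fin 3) (t r : ℝ) : kernel a κ γ 3 j t r =
    -((a + γ * κ) * r ^ 2) * kernel a κ γ 2 j t r
      - (r ^ 2 + γ * κ * a * r ^ 4) * kernel a κ γ 1 j t r - κ * r ^ 4 * kernel a κ γ 0 j t r := by
  simp [kernel, pow_succ, generator_zero, generator_one, generator_two]

lemma kernel_at_zero (a κ γ : ℝ) (k j : Fin 3) (r : ℝ) :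
    kernel a κ γ k j 0 r = if k = j then 1 else 0 := by
  fin_cases k <;> fin_cases j <;>
    simp [kernel, pow_succ, generator_zero, generator_one]

/-- An initial value 1 of u' costs r⁻² through (u'/r)², and of u'' costs r⁻⁴ through Θ²; this is the
source of the low frequency singularity of the second and third kernels. -/
lemma energy_kernel_at_zero (a κ γ : ℝ) (ha : 0 < a) (hγ : 1 < γ) :
    ∃ C : ℝ, 0 < C ∧ ∀ (j : Fin 3) (r : ℝ), 0 < r →
      energy a γ r (kernel a κ γ 0 j 0 r) (kernel a κ γ 1 j 0 r) (kernel a κ γ 2 j 0 r)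
        ≤ C * (1 + 1 / r ^ 2) ^ (j : ℕ) := by
  have hγ1 : 0 < γ - 1 := by linarith
  have hγ0 : 0 < γ := by linarith
  refine ⟨1 + γ + γ ^ 2 / (γ - 1) * (1 + a ^ 2 + (1 / γ) ^ 2), by positivity,
    fun j r hr => ?_⟩
  have e0 := kernel_at_zero a κ γ 0 j r
  have e1 := kernel_at_zero a κ γ 1 j r
  have e2 := kernel_at_zero a κ γ 2 j r
  simp only [Fin.val_zero, Fin.val_one, Fin.val_two] at e0 e1 e2
  set d := γ ^ 2 / (γ - 1) with hd
  have hd0 : 0 < d := by positivity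
  have hw : 0 < 1 / r ^ 2 := by positivity
  rw [e0, e1, e2]
  unfold energy
  rw [← hd]
  fin_cases j
  · simp only [Fin.zero_eta, Fin.isValue, if_true, one_ne_zero, if_false, Fin.reduceEq]
    have : (0 + a * r ^ 2 * 0 + r ^ 2 / γ * 1) / r ^ 2 = 1 / γ := by field_simp; ring
    rw [this]
    have : 0 ≤ d * a ^ 2 := by positivity
    simp only [zero_div, pow_zero]
    nlinarith
  · simp only [Fin.mk_one, Fin.isValue, if_true, zero_ne_one, if_false, Fin.reduceEq]
    have h1 : (0 + a * r ^ 2 * 1 + r ^ 2 / γ * 0) / r ^ 2 = a := by field_simp; ring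
    have h2 : (1 / r) ^ 2 = 1 / r ^ 2 := by field_simp
    rw [h1, h2, pow_one]
    set w := 1 / r ^ 2
    have : 0 ≤ d * (1 + (1 / γ) ^ 2) := by positivity
    have : 0 ≤ d * (1 + a ^ 2 + (1 / γ) ^ 2) * w := by positivity
    nlinarith
  · simp only [Fin.reduceFinMk, Fin.isValue, if_true, if_false, Fin.reduceEq]
    have h1 : (1 + a * r ^ 2 * 0 + r ^ 2 / γ * 0) / r ^ 2 = 1 / r ^ 2 := by ring
    rw [h1]
    set w := 1 / r ^ 2
    have : 0 ≤ d * (a ^ 2 + (1 / γ) ^ 2) * (1 + w) ^ 2 := by positivity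
    have : 0 ≤ (1 + γ) * (1 + w) ^ 2 := by positivity
    have : d * w ^ 2 ≤ d * (1 + w) ^ 2 := by gcongr; linarith
    simp only [zero_div]
    nlinarith

lemma kernel_energy_bound (a κ γ : ℝ) (ha : 0 < a) (hκ : 0 < κ) (hγ : 1 < γ) :
    ∃ c C : ℝ, 0 < c ∧ 0 < C ∧ ∀ (j : Fin 3) (r t : ℝ), 0 < r → 0 ≤ t →
      energy a γ r (kernel a κ γ 0 j t r) (kernel a κ γ 1 j t r) (kernel a κ γ 2 j t r)
        ≤ C * (1 + 1 / r ^ 2) ^ (j : ℕ) * Real.exp (-c * (r ^ 2 / (1 + r ^ 2)) * t) := by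
  obtain ⟨c, hc, h⟩ := energy_decay a κ γ ha hκ hγ
  obtain ⟨C, hC, h0⟩ := energy_kernel_at_zero a κ γ ha hγ
  refine ⟨c, 3 * C, hc, by positivity, fun j r t hr ht => ?_⟩
  have h1 := h r hr _ _ _ (fun t => hasDerivAt_kernel a κ γ 0 j t r)
    (fun t => hasDerivAt_kernel a κ γ 1 j t r)
    (fun t => by rw [← kernel_three]; exact hasDerivAt_kernel a κ γ 2 j t r) t ht
  have h2 := h0 j r hr
  refine h1.trans ?_
  have := mul_le_mul_of_nonneg_right h2 (Real.exp_pos (-c * (r ^ 2 / (1 + r ^ 2)) * t)).le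
  linarith

/-! ### Pointwise bounds on the kernels -/

lemma sq_le_energy (a γ r x y z : ℝ) (hγ : 1 < γ) (hr : 0 < r) :
    x ^ 2 ≤ energy a γ r x y z ∧ y ^ 2 ≤ r ^ 2 * energy a γ r x y z := by
  have hγ1 : 0 < γ - 1 := by linarith
  have hγ0 : 0 < γ := by linarith
  have h1 : 0 ≤ γ ^ 2 / (γ - 1) * ((z + a * r ^ 2 * y + r ^ 2 / γ * x) / r ^ 2) ^ 2 := by
    positivity
  have h2 : (y / r) ^ 2 ≤ γ * (y / r) ^ 2 := le_mul_of_one_le_left (by positivity) hγ.le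
  have h3 : y ^ 2 = r ^ 2 * (y / r) ^ 2 := by field_simp
  constructor
  · unfold energy; linarith [sq_nonneg (y / r)]
  · rw [h3]; gcongr; unfold energy; linarith [sq_nonneg x]

lemma kernel_sq_le (a κ γ : ℝ) (ha : 0 < a) (hκ : 0 < κ) (hγ : 1 < γ) :
    ∃ c C : ℝ, 0 < c ∧ 0 < C ∧ ∀ (j : Fin 3) (r t : ℝ), 0 < r → 0 ≤ t →
      kernel a κ γ 0 j t r ^ 2
        ≤ C * (1 + 1 / r ^ 2) ^ (j : ℕ) * Real.exp (-c * (r ^ 2 / (1 + r ^ 2)) * t) := by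
  obtain ⟨c, C, hc, hC, h⟩ := kernel_energy_bound a κ γ ha hκ hγ
  exact ⟨c, C, hc, hC, fun j r t hr ht =>
    (sq_le_energy a γ r _ _ _ hγ hr).1.trans (h j r t hr ht)⟩

/-- The energy controls the time derivative of this kernel by a constant over r, and the kernel
vanishes at t = 0. At small t this improves on the r⁻² given by the energy bound alone. -/
lemma kernel_two_le (a κ γ : ℝ) (ha : 0 < a) (hκ : 0 < κ) (hγ : 1 < γ) :
    ∃ C : ℝ, 0 < C ∧ ∀ (r t : ℝ), 0 < r → r ≤ 1 → 0 ≤ t → |kernel a κ γ 0 2 t r| ≤ C * t / r := by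
  obtain ⟨c, C, hc, hC, h⟩ := kernel_energy_bound a κ γ ha hκ hγ
  refine ⟨2 * √C, by positivity, fun r t hr hr1 ht => ?_⟩
  have hd : ∀ s, 0 ≤ s → |kernel a κ γ 1 2 s r| ≤ 2 * √C / r := fun s hs => by
    apply abs_le_of_sq_le_sq _ (by positivity)
    refine (sq_le_energy a γ r (kernel a κ γ 0 2 s r) _ (kernel a κ γ 2 2 s r) hγ hr).2.trans ?_
    have h1 := h 2 r s hr hs
    have h2 : Real.exp (-c * (r ^ 2 / (1 + r ^ 2)) * s) ≤ 1 := by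
      rw [Real.exp_le_one_iff]
      have : 0 ≤ c * (r ^ 2 / (1 + r ^ 2)) * s := by positivity
      linarith
    have h3 : (1 + 1 / r ^ 2) ≤ 2 / r ^ 2 := by
      rw [show (2 : ℝ) / r ^ 2 = 1 / r ^ 2 + 1 / r ^ 2 by ring]
      have : 1 ≤ 1 / r ^ 2 := by
        rw [le_div_iff₀ (by positivity)]; nlinarith
      linarith
    calc _ ≤ r ^ 2 * (C * (1 + 1 / r ^ 2) ^ 2 *
          Real.exp (-c * (r ^ 2 / (1 + r ^ 2)) * s)) := by gcongr; exact h1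
      _ ≤ r ^ 2 * (C * (2 / r ^ 2) ^ 2 * 1) := by gcongr
      _ = (2 * √C / r) ^ 2 := by
        rw [div_pow (2 * √C), mul_pow, Real.sq_sqrt hC.le]; field_simp
  have h2 := (convex_Icc 0 t).norm_image_sub_le_of_norm_hasDerivWithin_le
    (f := fun t => kernel a κ γ 0 2 t r) (f' := fun t => kernel a κ γ 1 2 t r)
    (C := 2 * √C / r) (x := 0) (y := t)
    (fun s _ => (hasDerivAt_kernel a κ γ 0 2 s r).hasDerivWithinAt) (fun s hs => hd s hs.1)
    (Set.left_mem_Icc.2 ht) (Set.right_mem_Icc.2 ht)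
  have h3 := kernel_at_zero a κ γ 0 2 r
  simp only [Fin.val_zero] at h3
  simp only [h3, Real.norm_eq_abs] at h2
  simp only [Fin.isValue, Fin.reduceEq, if_false, sub_zero, abs_of_nonneg ht] at h2
  calc _ ≤ _ := h2
    _ = _ := by ring

lemma exists_kernel_bound_compact (a κ γ T : ℝ) (k : ℕ) (j : Fin 3) :
    ∃ C : ℝ, 0 < C ∧ ∀ r t : ℝ, 0 ≤ r → r ≤ 1 → 0 ≤ t → t ≤ T → |kernel a κ γ k j t r| ≤ C := by
  obtain ⟨C, hC⟩ := (isCompact_Icc.prod isCompact_Icc).exists_bound_of_continuousOn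
    (s := Set.Icc (0 : ℝ) T ×ˢ Set.Icc (0 : ℝ) 1) (continuous_kernel a κ γ k j).continuousOn
  exact ⟨max C 1, by positivity, fun r t hr hr1 ht htT =>
    (hC (t, r) ⟨⟨ht, htT⟩, ⟨hr, hr1⟩⟩).trans (le_max_left _ _)⟩

/-- The energy is bounded for r ≥ 1. Its first two terms control u and u'/r; u'' is recovered from
the third, and the term a r² u' accounts for the power r³. -/
lemma exists_kernel_bound_high (a κ γ : ℝ) (ha : 0 < a) (hκ : 0 < κ) (hγ : 1 < γ) :
    ∃ C : ℝ, 0 < C ∧ ∀ (j : Fin 3) (r t : ℝ), 1 ≤ r → 0 ≤ t →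
      |kernel a κ γ 0 j t r| ≤ C ∧ |kernel a κ γ 1 j t r| ≤ C * r ∧
      |kernel a κ γ 2 j t r| ≤ C * r ^ 3 := by
  obtain ⟨c, C, hc, hC, h⟩ := kernel_energy_bound a κ γ ha hκ hγ
  have hγ1 : 0 < γ - 1 := by linarith
  have hγ0 : 0 < γ := by linarith
  set D := √(4 * C) with hD
  have hD0 : 0 < D := by positivity
  have hD2 : D ^ 2 = 4 * C := Real.sq_sqrt (by positivity)
  have key : ∀ (j : Fin 3) (r t : ℝ), 1 ≤ r → 0 ≤ t →
      energy a γ r (kernel a κ γ 0 j t r) (kernel a κ γ 1 j t r) (kernel a κ γ 2 j t r)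
        ≤ D ^ 2 := fun j r t hr ht => by
    have hr0 : 0 < r := by linarith
    refine (h j r t hr0 ht).trans ?_
    have h2 : Real.exp (-c * (r ^ 2 / (1 + r ^ 2)) * t) ≤ 1 := by
      rw [Real.exp_le_one_iff]
      have : 0 ≤ c * (r ^ 2 / (1 + r ^ 2)) * t := by positivity
      linarith
    have h3 : 1 + 1 / r ^ 2 ≤ 2 := by
      have : 1 / r ^ 2 ≤ 1 := by rw [div_le_one (by positivity)]; nlinarith
      linarith
    have h4 : (1 + 1 / r ^ 2) ^ (j : ℕ) ≤ 4 := by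
      calc (1 + 1 / r ^ 2) ^ (j : ℕ) ≤ (2 : ℝ) ^ (j : ℕ) := by gcongr
        _ ≤ 2 ^ 2 := pow_le_pow_right₀ (by norm_num) (by omega)
        _ = 4 := by norm_num
    calc _ ≤ C * 4 * 1 := by gcongr
      _ = _ := by rw [hD2]; ring
  refine ⟨D + (D * √((γ - 1) / γ ^ 2) + a * D + D / γ), by positivity, fun j r t hr ht => ?_⟩
  have hr0 : 0 < r := by linarith
  set x := kernel a κ γ 0 j t r
  set y := kernel a κ γ 1 j t r
  set z := kernel a κ γ 2 j t r
  have hE := key j r t hr ht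
  have hx : |x| ≤ D := abs_le_of_sq_le_sq ((sq_le_energy a γ r x y z hγ hr0).1.trans hE) hD0.le
  have hy : |y| ≤ D * r := by
    apply abs_le_of_sq_le_sq _ (by positivity)
    refine (sq_le_energy a γ r x y z hγ hr0).2.trans ?_
    rw [mul_pow, mul_comm]; gcongr
  have hθ : |(z + a * r ^ 2 * y + r ^ 2 / γ * x) / r ^ 2| ≤ D * √((γ - 1) / γ ^ 2) := by
    apply abs_le_of_sq_le_sq _ (by positivity)
    rw [mul_pow, Real.sq_sqrt (show 0 ≤ (γ - 1) / γ ^ 2 by positivity)]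
    have : γ ^ 2 / (γ - 1) * ((z + a * r ^ 2 * y + r ^ 2 / γ * x) / r ^ 2) ^ 2 ≤ D ^ 2 := by
      refine le_trans ?_ hE
      unfold energy
      have : 0 ≤ γ * (y / r) ^ 2 := by positivity
      linarith [sq_nonneg x]
    have h3 := mul_le_mul_of_nonneg_right this (show 0 ≤ (γ - 1) / γ ^ 2 by positivity)
    refine le_trans (le_of_eq ?_) h3
    field_simp
  have hz : z = (z + a * r ^ 2 * y + r ^ 2 / γ * x) / r ^ 2 * r ^ 2 - a * r ^ 2 * y
      - r ^ 2 / γ * x := by field_simp; ring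
  have hs : 0 ≤ D * √((γ - 1) / γ ^ 2) + a * D + D / γ := by positivity
  have hr3 : r ^ 2 ≤ r ^ 3 := pow_le_pow_right₀ hr (by norm_num)
  refine ⟨by linarith, ?_, ?_⟩
  · rw [add_mul]
    have := mul_nonneg hs hr0.le
    linarith
  · have h1 : |z| ≤ D * √((γ - 1) / γ ^ 2) * r ^ 2 + a * r ^ 2 * (D * r) + r ^ 2 / γ * D := by
      rw [hz]
      refine (abs_sub _ _).trans (add_le_add ((abs_sub _ _).trans (add_le_add ?_ ?_)) ?_)
      · rw [abs_mul, abs_of_nonneg (sq_nonneg r)]; gcongr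
      · rw [abs_mul, abs_of_nonneg (by positivity)]; gcongr
      · rw [abs_mul, abs_of_nonneg (by positivity)]; gcongr
    have h2 : D * √((γ - 1) / γ ^ 2) * r ^ 2 ≤ D * √((γ - 1) / γ ^ 2) * r ^ 3 := by gcongr
    have h3 : r ^ 2 / γ * D ≤ r ^ 3 / γ * D := by gcongr
    have h4 : 0 ≤ D * r ^ 3 := by positivity
    have h5 : r ^ 3 / γ * D = D / γ * r ^ 3 := by ring
    calc |z| ≤ _ := h1
      _ ≤ D * r ^ 3 + (D * √((γ - 1) / γ ^ 2) * r ^ 3 + a * D * r ^ 3 + D / γ * r ^ 3) := by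
        linarith
      _ = _ := by ring

lemma kernel_bounded (a κ γ T : ℝ) (ha : 0 < a) (hκ : 0 < κ) (hγ : 1 < γ) :
    ∃ C : ℝ, 0 < C ∧ ∀ (j : Fin 3) (r t : ℝ), 0 ≤ r → 0 ≤ t → t ≤ T →
      |kernel a κ γ 0 j t r| ≤ C := by
  obtain ⟨C, hC, h⟩ := exists_kernel_bound_high a κ γ ha hκ hγ
  choose D hD h' using fun j => exists_kernel_bound_compact a κ γ T 0 j
  refine ⟨C + ∑ j, D j, add_pos_of_pos_of_nonneg hC (Finset.sum_nonneg fun i _ => (hD i).le),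
    fun j r t hr ht htT => ?_⟩
  have h1 : D j ≤ ∑ j, D j := Finset.single_le_sum (fun i _ => (hD i).le) (Finset.mem_univ j)
  have h2 : 0 ≤ ∑ j, D j := Finset.sum_nonneg fun i _ => (hD i).le
  rcases le_total r 1 with hr1 | hr1
  · linarith [h' j r t hr hr1 ht htT]
  · linarith [(h j r t hr1 ht).1]

/-- Only polynomial growth in r, locally uniform in t, is needed to differentiate under integrals
against Schwartz functions. The exponent 5 comes from the third derivative, expressed by the
equation: r² · r³, r⁴ · r and r⁴ · 1. -/
lemma kernel_growth (a κ γ T : ℝ) (ha : 0 < a) (hκ : 0 < κ) (hγ : 1 < γ) (k : ℕ) (hk : k ≤ 3)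
    (j : Fin 3) :
    ∃ C : ℝ, 0 < C ∧ ∀ (r t : ℝ), 0 ≤ r → 0 ≤ t → t ≤ T →
      |kernel a κ γ k j t r| ≤ C * (1 + r) ^ 5 := by
  obtain ⟨C, hC, h⟩ := exists_kernel_bound_high a κ γ ha hκ hγ
  obtain ⟨D, hD, h'⟩ := exists_kernel_bound_compact a κ γ T k j
  have hγ0 : 0 < γ := by linarith
  set M := C + ((a + γ * κ) * C + (1 + γ * κ * a) * C + κ * C) with hM
  have hCM : C ≤ M := by rw [hM]; linarith [show 0 < (a + γ * κ) * C + (1 + γ * κ * a) * C + κ * C by positivity]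
  have hM0 : 0 < M := by linarith
  refine ⟨D + M, by positivity, fun r t hr ht htT => ?_⟩
  rcases le_total r 1 with hr1 | hr1
  · have h1 := h' r t hr hr1 ht htT
    have : 1 ≤ (1 + r) ^ 5 := one_le_pow₀ (by linarith)
    calc _ ≤ D := h1
      _ ≤ (D + M) * 1 := by linarith
      _ ≤ _ := by gcongr
  · suffices H : |kernel a κ γ k j t r| ≤ M * r ^ 5 by
      exact H.trans (mul_le_mul (by linarith) (pow_le_pow_left₀ (by linarith) (by linarith) 5)
        (by positivity) (by positivity))
    obtain ⟨h0, h1, h2⟩ := h j r t hr1 ht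
    have p1 : (1 : ℝ) ≤ r ^ 5 := one_le_pow₀ hr1
    have p2 : r ≤ r ^ 5 := le_self_pow₀ hr1 (by norm_num)
    have p3 : r ^ 3 ≤ r ^ 5 := pow_le_pow_right₀ hr1 (by norm_num)
    have p4 : r ^ 4 ≤ r ^ 5 := pow_le_pow_right₀ hr1 (by norm_num)
    interval_cases k
    · calc _ ≤ C * 1 := by linarith
        _ ≤ _ := by gcongr
    · calc _ ≤ C * r := h1
        _ ≤ _ := by gcongr
    · calc _ ≤ C * r ^ 3 := h2
        _ ≤ _ := by gcongr
    · rw [kernel_three]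
      have e1 : |-((a + γ * κ) * r ^ 2) * kernel a κ γ 2 j t r|
          ≤ (a + γ * κ) * r ^ 2 * (C * r ^ 3) := by
        rw [abs_mul, abs_neg, abs_of_nonneg (by positivity)]; gcongr
      have e2 : |(r ^ 2 + γ * κ * a * r ^ 4) * kernel a κ γ 1 j t r|
          ≤ (r ^ 4 + γ * κ * a * r ^ 4) * (C * r) := by
        rw [abs_mul, abs_of_nonneg (by positivity)]; gcongr; first | exact hr1 | norm_num
      have e3 : |κ * r ^ 4 * kernel a κ γ 0 j t r| ≤ κ * r ^ 5 * C := by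
        rw [abs_mul, abs_of_nonneg (by positivity)]; gcongr
      calc _ ≤ _ := (abs_sub _ _).trans (add_le_add ((abs_sub _ _).trans (add_le_add e1 e2)) e3)
        _ = ((a + γ * κ) * C + (1 + γ * κ * a) * C + κ * C) * r ^ 5 := by ring
        _ ≤ _ := by gcongr; linarith

/-! ### Fourier transforms of L², L¹ and Schwartz functions -/

variable {n : ℕ}

lemma pairing_fourierInv (v : Lp ℂ 2 (volume : Measure (Rn n))) (φ : 𝓢(Rn n, ℂ)) :
    pairing (𝓕⁻ v) φ = ∫ ξ, v ξ * (𝓕⁻ φ) ξ := by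
  have h := DFunLike.congr_fun (Lp.fourierInv_toTemperedDistribution_eq v) φ
  rw [TemperedDistribution.fourierInv_apply, Lp.toTemperedDistribution_apply,
    Lp.toTemperedDistribution_apply] at h
  simp only [smul_eq_mul] at h
  simpa only [pairing, mul_comm] using h.symm

lemma pairing_eq_integral_fourier (u : Lp ℂ 2 (volume : Measure (Rn n))) (φ : 𝓢(Rn n, ℂ)) :
    pairing u φ = ∫ ξ, (𝓕 u : Lp ℂ 2 (volume : Measure (Rn n))) ξ * (𝓕⁻ φ) ξ := by
  rw [← pairing_fourierInv, FourierTransform.fourierInv_fourier_eq]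

lemma integral_mul_eq_integral_fourier {f : Rn n → ℂ} (hf : Integrable f) (φ : 𝓢(Rn n, ℂ)) :
    ∫ x, f x * φ x = ∫ ξ, 𝓕 f ξ * (𝓕⁻ φ) ξ := by
  have h := VectorFourier.integral_fourierIntegral_smul_eq_flip (L := innerₗ (Rn n))
    (μ := volume) (ν := volume) Real.continuous_fourierChar continuous_inner hf
    (𝓕⁻ φ : 𝓢(Rn n, ℂ)).integrable
  have h2 : ∀ x, φ x = 𝓕 (⇑(𝓕⁻ φ : 𝓢(Rn n, ℂ))) x := fun x => by
    rw [← SchwartzMap.fourier_coe, FourierTransform.fourier_fourierInv_eq]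
  simp_rw [h2]
  simpa using! h.symm

lemma fourierInv_laplacian_apply (φ : 𝓢(Rn n, ℂ)) (ξ : Rn n) :
    (𝓕⁻ (Δ φ)) ξ = -((2 * π * ‖ξ‖ : ℝ) : ℂ) ^ 2 * (𝓕⁻ φ) ξ := by
  have h : 𝓕 (Δ φ) = -(2 * π) ^ 2 • SchwartzMap.smulLeftCLM ℂ (‖·‖ ^ 2 : Rn n → ℝ) (𝓕 φ) := by
    rw [SchwartzMap.laplacian_eq_fourierMultiplierCLM, SchwartzMap.fourierMultiplierCLM_apply,
      FourierTransform.fourier_smul, FourierTransform.fourier_fourierInv_eq]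
  have hg : (‖·‖ ^ 2 : Rn n → ℝ).HasTemperateGrowth := by fun_prop
  -- The symbol is even, so the formula for the forward transform carries over by reflecting the
  -- frequency.
  have hinv : ∀ f : 𝓢(Rn n, ℂ), (𝓕⁻ f) ξ = (𝓕 f) (-ξ) := fun f => by
    rw [SchwartzMap.fourierInv_coe, SchwartzMap.fourier_coe, Real.fourierInv_eq_fourier_neg]
  rw [hinv, hinv, h]
  simp [SchwartzMap.smulLeftCLM_apply_apply hg]
  ring

lemma ae_eq_of_integral_schwartz {u v : Rn n → ℂ} (hu : LocallyIntegrable u)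
    (hv : LocallyIntegrable v)
    (h : ∀ g : 𝓢(Rn n, ℂ), HasCompactSupport g → ∫ x, u x * g x = ∫ x, v x * g x) :
    u =ᵐ[volume] v := by
  refine ae_eq_of_integral_contDiff_smul_eq hu hv fun g hg hgc => ?_
  have hg₁ : HasCompactSupport (Complex.ofRealCLM ∘ g) := hgc.comp_left rfl
  have hg₂ : ContDiff ℝ (⊤ : ℕ∞) (Complex.ofRealCLM ∘ g) := by fun_prop
  have := h (hg₁.toSchwartzMap hg₂) hg₁
  simpa [mul_comm] using this

/-- Both the L² transform and the integral transform satisfy the same duality formula against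
Schwartz functions, which determines a locally integrable function almost everywhere. -/
lemma fourier_toLp_ae_eq {f : Rn n → ℂ} (hf : Integrable f) (hf2 : MemLp f 2) :
    (𝓕 (hf2.toLp f) : Lp ℂ 2 (volume : Measure (Rn n))) =ᵐ[volume] 𝓕 f := by
  have hc : Continuous (𝓕 f) := VectorFourier.fourierIntegral_continuous
    Real.continuous_fourierChar continuous_inner hf
  refine ae_eq_of_integral_schwartz ((Lp.memLp _).locallyIntegrable (by norm_num))
    hc.locallyIntegrable fun g _ => ?_
  have h1 := pairing_eq_integral_fourier (hf2.toLp f) (𝓕 g)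
  have h2 := integral_mul_eq_integral_fourier hf (𝓕 g)
  rw [FourierTransform.fourierInv_fourier_eq] at h1 h2
  rw [← h1, ← h2, pairing]
  refine integral_congr_ae ?_
  filter_upwards [hf2.coeFn_toLp] with x hx
  rw [hx]

lemma memLp_fourier {f : Rn n → ℂ} (hf : Integrable f) (hf2 : MemLp f 2) :
    MemLp (𝓕 f) 2 volume :=
  (memLp_congr_ae (fourier_toLp_ae_eq hf hf2)).1 (Lp.memLp _)

lemma eLpNorm_fourier {f : Rn n → ℂ} (hf : Integrable f) (hf2 : MemLp f 2) :
    eLpNorm (𝓕 f) 2 volume = eLpNorm f 2 volume := by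
  rw [← eLpNorm_congr_ae (fourier_toLp_ae_eq hf hf2), ← eLpNorm_congr_ae hf2.coeFn_toLp,
    ← Lp.enorm_def, ← Lp.enorm_def, enorm_eq_iff_norm_eq.2 (Lp.norm_fourier_eq _)]

/-- The mean is the transform at frequency zero; |e^{iθ} - 1| ≤ |θ| turns the weight |x| into a
factor |ξ|. -/
lemma norm_fourier_sub_mean_le {f : Rn n → ℂ} (hf : MemData f) (ξ : Rn n) :
    ‖𝓕 f ξ - mean f‖ ≤ 2 * π * ‖ξ‖ * normL11 f := by
  have hb : ∀ x : Rn n, ‖Real.fourierChar (-inner ℝ x ξ) • f x - f x‖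
      ≤ 2 * π * ‖ξ‖ * ((1 + ‖x‖) * ‖f x‖) := fun x => by
    have h1 : ‖((Real.fourierChar (-inner ℝ x ξ) : Circle) : ℂ) - 1‖ ≤ 2 * π * (‖x‖ * ‖ξ‖) := by
      rw [Real.fourierChar_apply, mul_comm _ Complex.I]
      refine (Real.norm_exp_I_mul_ofReal_sub_one_le).trans ?_
      rw [Real.norm_eq_abs, abs_mul, abs_of_pos Real.two_pi_pos, abs_neg]
      gcongr
      exact abs_real_inner_le_norm x ξ
    have h2 : Real.fourierChar (-inner ℝ x ξ) • f x - f x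
        = (((Real.fourierChar (-inner ℝ x ξ) : Circle) : ℂ) - 1) * f x := by
      rw [Circle.smul_def, smul_eq_mul]; ring
    rw [h2, norm_mul]
    calc _ ≤ 2 * π * (‖x‖ * ‖ξ‖) * ‖f x‖ := by gcongr
      _ ≤ 2 * π * ((1 + ‖x‖) * ‖ξ‖) * ‖f x‖ := by gcongr; linarith
      _ = _ := by ring
  have hi : Integrable fun x => Real.fourierChar (-inner ℝ x ξ) • f x := by
    simpa using (Real.fourierIntegral_convergent_iff (μ := volume) (f := f) ξ).2 hf.integrable
  rw [Real.fourier_eq, mean, ← integral_sub hi hf.integrable, normL11, ← integral_const_mul]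
  exact norm_integral_le_of_norm_le (hf.weighted.const_mul _) (.of_forall hb)

lemma normL2_sq {n : ℕ} {f : Rn n → ℂ} (hf : MemLp f 2 volume) :
    normL2 f ^ 2 = ∫ x, ‖f x‖ ^ 2 := by
  have h0 : 0 ≤ ∫ x, ‖f x‖ ^ 2 := integral_nonneg fun x => by positivity
  rw [normL2, hf.eLpNorm_eq_integral_rpow_norm (by norm_num) (by norm_num)]
  simp only [ENNReal.toReal_ofNat, Real.rpow_two]
  rw [ENNReal.toReal_ofReal (by positivity), ← Real.rpow_natCast, ← Real.rpow_mul h0]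
  norm_num

lemma norm_toLp_eq_normL2 {n : ℕ} {f : Rn n → ℂ} (hf : MemLp f 2 volume) :
    ‖hf.toLp f‖ = normL2 f := by
  rw [Lp.norm_toLp, normL2]

/-! ### One-sided time derivatives -/

/-- Differentiation under the integral sign on the half line, one-sided at the endpoint. -/
lemma hasDerivWithinAt_integral_Ici {α : Type*} [MeasurableSpace α] {μ : Measure α}
    {F F' : ℝ → α → ℂ} {bound : α → ℝ} {t T : ℝ} (ht : 0 ≤ t) (htT : t < T)
    (hF : ∀ s, 0 ≤ s → s ≤ T → Integrable (F s) μ) (hb : Integrable bound μ)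
    (hF' : ∀ s, 0 ≤ s → s ≤ T → ∀ x, ‖F' s x‖ ≤ bound x)
    (hd : ∀ x s, 0 ≤ s → HasDerivAt (fun s => F s x) (F' s x) s) :
    HasDerivWithinAt (fun s => ∫ x, F s x ∂μ) (∫ x, F' t x ∂μ) (Set.Ici 0) t := by
  rw [hasDerivWithinAt_iff_tendsto_slope]
  have hev : ∀ᶠ s in 𝓝[Set.Ici 0 \ {t}] t, 0 ≤ s ∧ s ≤ T := by
    have h1 : ∀ᶠ s in 𝓝[Set.Ici 0 \ {t}] t, s < T :=
      nhdsWithin_le_nhds (eventually_lt_nhds htT)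
    filter_upwards [h1, self_mem_nhdsWithin] with s hs hs' using ⟨hs'.1, hs.le⟩
  have hl : Tendsto (fun s => ∫ x, slope (fun s => F s x) t s ∂μ) (𝓝[Set.Ici 0 \ {t}] t)
      (𝓝 (∫ x, F' t x ∂μ)) := by
    refine tendsto_integral_filter_of_dominated_convergence bound ?_ ?_ hb ?_
    · filter_upwards [hev] with s hs
      have := (((hF s hs.1 hs.2).sub (hF t ht htT.le)).smul ((s - t)⁻¹)).aestronglyMeasurable
      exact this
    · filter_upwards [hev] with s hs
      refine .of_forall fun x => ?_
      have h := (convex_Icc 0 T).norm_image_sub_le_of_norm_hasDerivWithin_le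
        (f := fun s => F s x) (f' := fun s => F' s x) (C := bound x) (x := t) (y := s)
        (fun u hu => (hd x u hu.1).hasDerivWithinAt) (fun u hu => hF' u hu.1 hu.2 x)
        ⟨ht, htT.le⟩ hs
      rw [slope_def_module, norm_smul, norm_inv]
      rcases eq_or_ne s t with rfl | hst
      · simpa using (norm_nonneg _).trans (hF' s hs.1 hs.2 x)
      · rw [inv_mul_le_iff₀ (norm_pos_iff.2 (sub_ne_zero.2 hst)), mul_comm]
        exact h
    · exact .of_forall fun x =>
        (hasDerivWithinAt_iff_tendsto_slope.1 (hd x t ht).hasDerivWithinAt)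
  refine hl.congr' ?_
  filter_upwards [hev] with s hs
  simp only [slope_def_module]
  rw [integral_smul, integral_sub (hF s hs.1 hs.2) (hF t ht htT.le)]

/-- A chain of one-sided derivatives computes the iterated derivatives. -/
lemma iteratedDerivWithin_eq_of_chain {f : ℝ → ℂ} {h : ℕ → ℝ → ℂ} {N : ℕ}
    (h0 : Set.EqOn f (h 0) (Set.Ici 0))
    (hd : ∀ k < N, ∀ t, 0 ≤ t → HasDerivWithinAt (h k) (h (k + 1) t) (Set.Ici 0) t) :
    ∀ k ≤ N, ∀ t, 0 ≤ t → iteratedDerivWithin k f (Set.Ici 0) t = h k t := by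
  intro k
  induction k with
  | zero => intro _ t ht; rw [iteratedDerivWithin_zero]; exact h0 ht
  | succ k ih =>
    intro hk t ht
    have hk' : Set.EqOn (iteratedDerivWithin k f (Set.Ici 0)) (h k) (Set.Ici 0) :=
      fun s hs => ih (by omega) s hs
    rw [iteratedDerivWithin_succ, derivWithin_congr hk' (hk' ht)]
    exact (hd k (by omega) t ht).derivWithin (uniqueDiffOn_Ici 0 t ht)

lemma contDiffOn_of_chain {f : ℝ → ℂ} {h : ℕ → ℝ → ℂ} {N : ℕ}
    (h0 : Set.EqOn f (h 0) (Set.Ici 0))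
    (hd : ∀ k < N, ∀ t, 0 ≤ t → HasDerivWithinAt (h k) (h (k + 1) t) (Set.Ici 0) t)
    (hc : ContinuousOn (h N) (Set.Ici 0)) : ContDiffOn ℝ N f (Set.Ici 0) := by
  have key := iteratedDerivWithin_eq_of_chain h0 hd
  refine contDiffOn_of_continuousOn_differentiableOn_deriv (n := N) (fun m hm => ?_)
    (fun m hm => ?_)
  · have hm' : m ≤ N := by exact_mod_cast hm
    refine ContinuousOn.congr ?_ (key m hm')
    rcases hm'.eq_or_lt with rfl | hlt
    · exact hc
    · exact fun t ht => (hd m hlt t ht).continuousWithinAt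
  · have hm' : m < N := by exact_mod_cast hm
    exact fun t ht => ((hd m hm' t ht).congr (key m hm'.le)
      (key m hm'.le t ht)).differentiableWithinAt

/-! ### Existence -/

/-- The spatial Fourier transform of the `k`-th time derivative of the solution, for initial data
with Fourier transforms `f`. -/
noncomputable def fourierSol (a κ γ : ℝ) (f : Fin 3 → Rn n → ℂ) (k : ℕ) (t : ℝ) (ξ : Rn n) : ℂ :=
  ∑ j, (kernel a κ γ k j t (2 * π * ‖ξ‖) : ℂ) * f j ξ

lemma hasDerivAt_fourierSol (a κ γ : ℝ) (f : Fin 3 → Rn n → ℂ) (k : ℕ) (t : ℝ) (ξ : Rn n) :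
    HasDerivAt (fun t => fourierSol a κ γ f k t ξ) (fourierSol a κ γ f (k + 1) t ξ) t := by
  unfold fourierSol
  exact HasDerivAt.fun_sum fun j _ => ((hasDerivAt_kernel a κ γ k j t _).ofReal_comp).mul_const _

lemma continuous_kernel_norm (a κ γ : ℝ) (k : ℕ) (j : Fin 3) (t : ℝ) :
    Continuous fun ξ : Rn n => (kernel a κ γ k j t (2 * π * ‖ξ‖) : ℂ) := by
  have h1 : Continuous fun ξ : Rn n => (t, 2 * π * ‖ξ‖) := by fun_prop
  have h2 := (continuous_kernel a κ γ k j).comp h1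
  exact Complex.continuous_ofReal.comp h2

lemma continuous_fourierSol (a κ γ : ℝ) {f : Fin 3 → Rn n → ℂ} (hf : ∀ j, Continuous (f j))
    (k : ℕ) (t : ℝ) : Continuous (fourierSol a κ γ f k t) := by
  unfold fourierSol
  exact continuous_finsetSum _ fun j _ => (continuous_kernel_norm a κ γ k j t).mul (hf j)

lemma norm_fourierSol_le {a κ γ : ℝ} {f : Fin 3 → Rn n → ℂ} {k : ℕ} {t C : ℝ} {ξ : Rn n}
    (h : ∀ j, |kernel a κ γ k j t (2 * π * ‖ξ‖)| ≤ C) :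
    ‖fourierSol a κ γ f k t ξ‖ ≤ C * ∑ j, ‖f j ξ‖ := by
  unfold fourierSol
  refine (norm_sum_le _ _).trans ?_
  rw [Finset.mul_sum]
  refine Finset.sum_le_sum fun j _ => ?_
  rw [norm_mul, Complex.norm_real]
  exact mul_le_mul_of_nonneg_right (h j) (norm_nonneg _)

lemma memLp_fourierSol {a κ γ : ℝ} (ha : 0 < a) (hκ : 0 < κ) (hγ : 1 < γ)
    {f : Fin 3 → Rn n → ℂ} (hf : ∀ j, MemLp (f j) 2 volume) {t : ℝ} (ht : 0 ≤ t) :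
    MemLp (fourierSol a κ γ f 0 t) 2 volume := by
  obtain ⟨C, hC, hK⟩ := kernel_bounded a κ γ t ha hκ hγ
  have h2 : MemLp (fun ξ => ∑ j, ‖f j ξ‖) 2 volume := memLp_finsetSum _ fun j _ => (hf j).norm
  refine (h2.const_mul C).of_le ?_ (.of_forall fun ξ => ?_)
  · unfold fourierSol
    exact Finset.aestronglyMeasurable_fun_sum _ fun j _ =>
      (continuous_kernel_norm a κ γ 0 j t).aestronglyMeasurable.mul (hf j).aestronglyMeasurable
  · have := norm_fourierSol_le (f := f) fun j => hK j (2 * π * ‖ξ‖) t (by positivity) ht le_rfl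
    exact this.trans (le_abs_self _)

/-- The solution operator. -/
noncomputable def solution {a κ γ : ℝ} (ha : 0 < a) (hκ : 0 < κ) (hγ : 1 < γ)
    {f : Fin 3 → Rn n → ℂ} (hf : ∀ j, MemLp (f j) 2 volume) (t : ℝ) :
    Lp ℂ 2 (volume : Measure (Rn n)) :=
  -- Square integrability is available only for nonnegative times; clamping the time at zero makes
  -- the function total.
  𝓕⁻ ((memLp_fourierSol ha hκ hγ hf (le_max_right t 0)).toLp)

lemma norm_solution {a κ γ : ℝ} (ha : 0 < a) (hκ : 0 < κ) (hγ : 1 < γ)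
    {f : Fin 3 → Rn n → ℂ} (hf : ∀ j, MemLp (f j) 2 volume) {t : ℝ} (ht : 0 ≤ t) :
    ‖solution ha hκ hγ hf t‖ = normL2 (fourierSol a κ γ f 0 t) := by
  have h : ∀ u : Lp ℂ 2 (volume : Measure (Rn n)), ‖(𝓕⁻ u : Lp ℂ 2 volume)‖ = ‖u‖ := fun u =>
    (Lp.fourierTransformₗᵢ (Rn n) ℂ).symm.norm_map u
  rw [solution, h, norm_toLp_eq_normL2, max_eq_left ht]

/-- By Plancherel this is continuity on the Fourier side, which follows from dominated convergence:
the kernels are continuous in t and bounded in r, uniformly for t in compact intervals. -/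
lemma continuous_solution {a κ γ : ℝ} (ha : 0 < a) (hκ : 0 < κ) (hγ : 1 < γ)
    {f : Fin 3 → Rn n → ℂ} (hf : ∀ j, MemLp (f j) 2 volume) :
    Continuous (solution ha hκ hγ hf) := by
  refine (Lp.fourierTransformₗᵢ (Rn n) ℂ).symm.continuous.comp ?_
  rw [continuous_iff_continuousAt]
  intro t₀
  obtain ⟨C, hC, hK⟩ := kernel_bounded a κ γ (max t₀ 0 + 1) ha hκ hγ
  have hev : ∀ᶠ t in 𝓝 t₀, max t 0 ≤ max t₀ 0 + 1 := by
    have : Continuous fun t : ℝ => max t 0 := by fun_prop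
    exact this.continuousAt.eventually (eventually_le_nhds (by linarith))
  rw [ContinuousAt, tendsto_iff_norm_sub_tendsto_zero]
  have hsq : Tendsto (fun t => ∫ ξ, ‖fourierSol a κ γ f 0 (max t 0) ξ
      - fourierSol a κ γ f 0 (max t₀ 0) ξ‖ ^ 2) (𝓝 t₀) (𝓝 (∫ _ : Rn n, (0 : ℝ))) := by
    have h2 : MemLp (fun ξ => 2 * C * ∑ j, ‖f j ξ‖) 2 volume :=
      (memLp_finsetSum _ fun j _ => (hf j).norm).const_mul (2 * C)
    refine tendsto_integral_filter_of_dominated_convergence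
      (fun ξ => ‖2 * C * ∑ j, ‖f j ξ‖‖ ^ 2) ?_ ?_ (h2.integrable_norm_pow (by norm_num)) ?_
    · refine .of_forall fun t => ?_
      exact (((memLp_fourierSol ha hκ hγ hf (le_max_right t 0)).sub (memLp_fourierSol ha hκ hγ hf
        (le_max_right t₀ 0))).aestronglyMeasurable.norm).pow 2
    · filter_upwards [hev] with t ht
      refine .of_forall fun ξ => ?_
      rw [norm_pow, norm_norm]
      gcongr
      have h1 := norm_fourierSol_le (f := f) fun j =>
        hK j (2 * π * ‖ξ‖) (max t 0) (by positivity) (le_max_right _ _) ht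
      have h2 := norm_fourierSol_le (f := f) fun j =>
        hK j (2 * π * ‖ξ‖) (max t₀ 0) (by positivity) (le_max_right _ _) (by linarith)
      rw [Real.norm_of_nonneg (by positivity)]
      refine (norm_sub_le _ _).trans ?_
      linarith
    · refine .of_forall fun ξ => ?_
      have hc : Continuous fun t => fourierSol a κ γ f 0 (max t 0) ξ := by
        have : Continuous fun t => fourierSol a κ γ f 0 t ξ := continuous_iff_continuousAt.2
          fun t => (hasDerivAt_fourierSol a κ γ f 0 t ξ).continuousAt
        exact this.comp (by fun_prop)
      have h3 : Continuous fun t => ‖fourierSol a κ γ f 0 (max t 0) ξ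
          - fourierSol a κ γ f 0 (max t₀ 0) ξ‖ ^ 2 := by fun_prop
      simpa using h3.tendsto t₀
  have h4 := hsq.sqrt
  simp only [integral_zero, Real.sqrt_zero] at h4
  refine h4.congr fun t => ?_
  have hm := (memLp_fourierSol ha hκ hγ hf (le_max_right t 0)).sub
    (memLp_fourierSol ha hκ hγ hf (le_max_right t₀ 0))
  rw [← MemLp.toLp_sub, norm_toLp_eq_normL2, ← Real.sqrt_sq (show 0 ≤ normL2 _ from
    ENNReal.toReal_nonneg), normL2_sq hm]
  rfl

lemma integrable_one_add_pow_mul_schwartz (g : 𝓢(Rn n, ℂ)) :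
    Integrable fun ξ : Rn n => (1 + 2 * π * ‖ξ‖) ^ 5 * ‖g ξ‖ := by
  have h0 := g.integrable_pow_mul volume 0
  have h5 := g.integrable_pow_mul volume 5
  refine ((h0.add (h5.const_mul ((2 * π) ^ 5))).const_mul (2 ^ 4)).mono' ?_
    (.of_forall fun ξ => ?_)
  · exact (by fun_prop : Continuous fun ξ : Rn n => (1 + 2 * π * ‖ξ‖) ^ 5 * ‖g ξ‖).aestronglyMeasurable
  · rw [Real.norm_of_nonneg (by positivity)]
    have := add_pow_le zero_le_one (show 0 ≤ 2 * π * ‖ξ‖ by positivity) 5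
    calc _ ≤ 2 ^ (5 - 1) * (1 ^ 5 + (2 * π * ‖ξ‖) ^ 5) * ‖g ξ‖ := by gcongr
      _ = _ := by simp only [Pi.add_apply]; ring

/-- Supplies a majorant independent of t in [0, T], integrable thanks to the Schwartz factor. -/
lemma norm_fourierSol_mul_le {a κ γ : ℝ} (ha : 0 < a) (hκ : 0 < κ) (hγ : 1 < γ)
    {f : Fin 3 → Rn n → ℂ} {B : ℝ} (hB : ∀ j ξ, ‖f j ξ‖ ≤ B) {k : ℕ} (hk : k ≤ 3)
    (T : ℝ) (g : 𝓢(Rn n, ℂ)) :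
    ∃ C : ℝ, ∀ t, 0 ≤ t → t ≤ T → ∀ ξ,
      ‖fourierSol a κ γ f k t ξ * g ξ‖ ≤ C * ((1 + 2 * π * ‖ξ‖) ^ 5 * ‖g ξ‖) := by
  choose C hC h using fun j => kernel_growth a κ γ T ha hκ hγ k hk j
  refine ⟨(∑ j, C j) * ∑ _j : Fin 3, B, fun t ht htT ξ => ?_⟩
  have h1 := norm_fourierSol_le (f := f) (ξ := ξ) (k := k) (t := t)
    (C := (∑ j, C j) * (1 + 2 * π * ‖ξ‖) ^ 5) fun j => by
      refine (h j (2 * π * ‖ξ‖) t (by positivity) ht htT).trans ?_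
      gcongr
      exact Finset.single_le_sum (fun i _ => (hC i).le) (Finset.mem_univ j)
  have h2 : ∑ j, ‖f j ξ‖ ≤ ∑ _j : Fin 3, B := Finset.sum_le_sum fun j _ => hB j ξ
  have h3 : 0 ≤ ∑ j, C j := Finset.sum_nonneg fun i _ => (hC i).le
  rw [norm_mul]
  calc _ ≤ (∑ j, C j) * (1 + 2 * π * ‖ξ‖) ^ 5 * (∑ j, ‖f j ξ‖) * ‖g ξ‖ := by gcongr
    _ ≤ (∑ j, C j) * (1 + 2 * π * ‖ξ‖) ^ 5 * (∑ _j : Fin 3, B) * ‖g ξ‖ := by gcongr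
    _ = _ := by ring

/-- The pairing of the `k`-th time derivative with a test function, on the Fourier side. -/
noncomputable def fourierPairing (a κ γ : ℝ) (f : Fin 3 → Rn n → ℂ) (φ : 𝓢(Rn n, ℂ)) (k : ℕ)
    (t : ℝ) : ℂ :=
  ∫ ξ, fourierSol a κ γ f k t ξ * (𝓕⁻ φ) ξ

section
variable {a κ γ : ℝ} {f : Fin 3 → Rn n → ℂ} {B : ℝ}

lemma integrable_fourierSol_mul (ha : 0 < a) (hκ : 0 < κ) (hγ : 1 < γ)
    (hc : ∀ j, Continuous (f j)) (hB : ∀ j ξ, ‖f j ξ‖ ≤ B)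
    (g : 𝓢(Rn n, ℂ)) {k : ℕ} (hk : k ≤ 3) {t : ℝ} (ht : 0 ≤ t) :
    Integrable fun ξ => fourierSol a κ γ f k t ξ * g ξ := by
  obtain ⟨C, h⟩ := norm_fourierSol_mul_le ha hκ hγ hB hk t g
  exact ((integrable_one_add_pow_mul_schwartz g).const_mul C).mono'
    ((continuous_fourierSol a κ γ hc k t).mul g.continuous).aestronglyMeasurable
    (.of_forall fun ξ => h t ht le_rfl ξ)

lemma hasDerivWithinAt_fourierPairing (ha : 0 < a) (hκ : 0 < κ) (hγ : 1 < γ)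
    (hc : ∀ j, Continuous (f j)) (hB : ∀ j ξ, ‖f j ξ‖ ≤ B)
    (φ : 𝓢(Rn n, ℂ)) {k : ℕ} (hk : k < 3) {t : ℝ} (ht : 0 ≤ t) :
    HasDerivWithinAt (fourierPairing a κ γ f φ k) (fourierPairing a κ γ f φ (k + 1) t)
      (Set.Ici 0) t := by
  obtain ⟨C, h⟩ := norm_fourierSol_mul_le ha hκ hγ hB (show k + 1 ≤ 3 by omega) (t + 1) (𝓕⁻ φ)
  exact hasDerivWithinAt_integral_Ici (T := t + 1) ht (by linarith)
    (fun s hs _ => integrable_fourierSol_mul ha hκ hγ hc hB _ hk.le hs)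
    ((integrable_one_add_pow_mul_schwartz (𝓕⁻ φ)).const_mul C) h
    (fun ξ s _ => (hasDerivAt_fourierSol a κ γ f k s ξ).mul_const _)

lemma continuousOn_fourierPairing (ha : 0 < a) (hκ : 0 < κ) (hγ : 1 < γ)
    (hc : ∀ j, Continuous (f j)) (hB : ∀ j ξ, ‖f j ξ‖ ≤ B)
    (φ : 𝓢(Rn n, ℂ)) {k : ℕ} (hk : k ≤ 3) :
    ContinuousOn (fourierPairing a κ γ f φ k) (Set.Ici 0) := by
  intro t ht
  obtain ⟨C, h⟩ := norm_fourierSol_mul_le ha hκ hγ hB hk (t + 1) (𝓕⁻ φ)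
  refine tendsto_integral_filter_of_dominated_convergence _ ?_ ?_
    ((integrable_one_add_pow_mul_schwartz (𝓕⁻ φ)).const_mul C) ?_
  · exact .of_forall fun s =>
      ((continuous_fourierSol a κ γ hc k s).mul (𝓕⁻ φ).continuous).aestronglyMeasurable
  · have h1 : ∀ᶠ s in 𝓝[Set.Ici 0] t, s < t + 1 :=
      nhdsWithin_le_nhds (eventually_lt_nhds (by linarith))
    filter_upwards [h1, self_mem_nhdsWithin] with s hs hs'
    exact .of_forall fun ξ => h s hs' hs.le ξ
  · exact .of_forall fun ξ =>
      ((hasDerivAt_fourierSol a κ γ f k t ξ).mul_const _).continuousAt.continuousWithinAt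

lemma pairing_solution (ha : 0 < a) (hκ : 0 < κ) (hγ : 1 < γ)
    (hf : ∀ j, MemLp (f j) 2 volume) (φ : 𝓢(Rn n, ℂ)) :
    Set.EqOn (fun t => pairing (solution ha hκ hγ hf t) φ) (fourierPairing a κ γ f φ 0)
      (Set.Ici 0) := by
  intro t ht
  simp only [solution, fourierPairing, pairing_fourierInv]
  refine integral_congr_ae ?_
  filter_upwards [(memLp_fourierSol ha hκ hγ hf (le_max_right t 0)).coeFn_toLp] with ξ hξ
  rw [hξ, max_eq_left ht]

lemma dtPairing_solution (ha : 0 < a) (hκ : 0 < κ) (hγ : 1 < γ)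
    (hc : ∀ j, Continuous (f j)) (hB : ∀ j ξ, ‖f j ξ‖ ≤ B)
    (hf : ∀ j, MemLp (f j) 2 volume) (φ : 𝓢(Rn n, ℂ)) {k : ℕ} (hk : k ≤ 3) {t : ℝ}
    (ht : 0 ≤ t) :
    dtPairing k (solution ha hκ hγ hf) φ t = fourierPairing a κ γ f φ k t :=
  iteratedDerivWithin_eq_of_chain (pairing_solution ha hκ hγ hf φ)
    (fun _ hk _ ht => hasDerivWithinAt_fourierPairing ha hκ hγ hc hB φ hk ht) k hk t ht

end

lemma fourierSol_three (a κ γ : ℝ) (f : Fin 3 → Rn n → ℂ) (t : ℝ) (ξ : Rn n) :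
    fourierSol a κ γ f 3 t ξ = -((a + γ * κ) * (2 * π * ‖ξ‖) ^ 2 : ℝ) * fourierSol a κ γ f 2 t ξ
      - ((2 * π * ‖ξ‖) ^ 2 + γ * κ * a * (2 * π * ‖ξ‖) ^ 4 : ℝ) * fourierSol a κ γ f 1 t ξ
      - (κ * (2 * π * ‖ξ‖) ^ 4 : ℝ) * fourierSol a κ γ f 0 t ξ := by
  simp only [fourierSol, kernel_three, Finset.mul_sum, ← Finset.sum_sub_distrib]
  refine Finset.sum_congr rfl fun j _ => ?_
  push_cast
  ring

lemma fourierSol_at_zero (a κ γ : ℝ) (f : Fin 3 → Rn n → ℂ) (k : Fin 3) :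
    fourierSol a κ γ f k 0 = f k := by
  ext ξ
  simp only [fourierSol, kernel_at_zero]
  rw [Finset.sum_eq_single k] <;> simp +contextual [eq_comm]

lemma integral_combination_eq_zero {F G H K L : Rn n → ℂ} {c d e : ℂ} (hF : Integrable F)
    (hG : Integrable G) (hH : Integrable H) (hK : Integrable K) (hL : Integrable L)
    (h : ∀ x, F x - c * G x - H x + d * K x + e * L x = 0) :
    (∫ x, F x) - c * (∫ x, G x) - (∫ x, H x) + d * (∫ x, K x) + e * (∫ x, L x) = 0 := by
  have h1 := hF.sub (hG.const_mul c)
  have h2 := h1.sub hH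
  have h3 := h2.add (hK.const_mul d)
  rw [← integral_const_mul, ← integral_const_mul, ← integral_const_mul,
    ← integral_sub' hF (hG.const_mul c), ← integral_sub' h1 hH,
    ← integral_add' h2 (hK.const_mul d), ← integral_add' h3 (hL.const_mul e)]
  exact integral_eq_zero_of_ae (.of_forall h)

theorem isSolution_solution {b ν κ γ : ℝ} (ha : 0 < b * ν) (hκ : 0 < κ) (hγ : 1 < γ)
    {ψ : Fin 3 → Rn n → ℂ} (hψ : ∀ j, MemData (ψ j))
    (hf : ∀ j, MemLp (𝓕 (ψ j)) 2 volume) :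
    IsSolution b ν κ γ (ψ 0) (ψ 1) (ψ 2) (solution ha hκ hγ hf) := by
  have hc : ∀ j, Continuous (𝓕 (ψ j)) := fun j => VectorFourier.fourierIntegral_continuous
    Real.continuous_fourierChar continuous_inner (hψ j).integrable
  have hB : ∀ j ξ, ‖𝓕 (ψ j) ξ‖ ≤ ∑ j, ∫ x, ‖ψ j x‖ := fun j ξ => by
    refine (VectorFourier.norm_fourierIntegral_le_integral_norm _ _ _ _ _).trans ?_
    exact Finset.single_le_sum (f := fun j => ∫ x, ‖ψ j x‖)
      (fun i _ => integral_nonneg fun x => norm_nonneg _) (Finset.mem_univ j)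
  have hdt := fun φ {k} hk {t} ht =>
    dtPairing_solution (k := k) (t := t) ha hκ hγ hc hB hf φ hk ht
  have hinit : ∀ (k : Fin 3) (φ : 𝓢(Rn n, ℂ)),
      dtPairing k (solution ha hκ hγ hf) φ 0 = ∫ x, ψ k x * φ x := fun k φ => by
    rw [hdt φ (by omega) le_rfl, fourierPairing, fourierSol_at_zero,
      integral_mul_eq_integral_fourier (hψ k).integrable]
  refine ⟨(continuous_solution ha hκ hγ hf).continuousOn, fun φ => ?_, fun φ t ht => ?_,
    hinit 0, hinit 1, hinit 2⟩
  · exact contDiffOn_of_chain (N := 3) (pairing_solution ha hκ hγ hf φ)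
      (fun _ hk _ ht => hasDerivWithinAt_fourierPairing ha hκ hγ hc hB φ hk ht)
      (continuousOn_fourierPairing ha hκ hγ hc hB φ le_rfl)
  · have hI := fun (φ : 𝓢(Rn n, ℂ)) {k} (hk : k ≤ 3) =>
      integrable_fourierSol_mul (k := k) ha hκ hγ hc hB (𝓕⁻ φ) hk ht.le
    simp only [hdt _ (show 3 ≤ 3 by norm_num) ht.le, hdt _ (show 2 ≤ 3 by norm_num) ht.le,
      hdt _ (show 1 ≤ 3 by norm_num) ht.le, hdt _ (show 0 ≤ 3 by norm_num) ht.le,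
      fourierPairing]
    refine integral_combination_eq_zero (hI _ le_rfl) (hI _ (by norm_num)) (hI _ (by norm_num))
      (hI _ (by norm_num)) (hI _ (by norm_num)) fun ξ => ?_
    -- With a = bν the coefficients match: δ + κ = a + γκ and κδ + κ(γ-1)(bν-κ) = γκa.
    simp only [fourierInv_laplacian_apply, fourierSol_three, soundDiffusivity]
    push_cast
    ring

/-! ### Uniqueness -/

lemma norm_le_of_hasDerivWithinAt_Ici {f f' : ℝ → ℂ} {t A : ℝ} (ht : 0 ≤ t) (h0 : f 0 = 0)
    (hd : ∀ s, 0 ≤ s → HasDerivWithinAt f (f' s) (Set.Ici 0) s)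
    (hb : ∀ s, 0 ≤ s → s ≤ t → ‖f' s‖ ≤ A) : ‖f t‖ ≤ A * t := by
  have h := (convex_Icc 0 t).norm_image_sub_le_of_norm_hasDerivWithin_le
    (f := f) (f' := f') (C := A) (x := 0) (y := t)
    (fun s hs => (hd s hs.1).mono Set.Icc_subset_Ici_self) (fun s hs => hb s hs.1 hs.2)
    (Set.left_mem_Icc.2 ht) (Set.right_mem_Icc.2 ht)
  simpa [h0, abs_of_nonneg ht] using h

lemma norm_le_pow_div_factorial {f f' : ℝ → ℂ} {T A C : ℝ} (m : ℕ) (h0 : f 0 = 0)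
    (hd : ∀ s, 0 ≤ s → HasDerivWithinAt f (f' s) (Set.Ici 0) s)
    (hb : ∀ s, 0 ≤ s → s ≤ T → ‖f' s‖ ≤ C * (A * ((C * s) ^ m / m.factorial))) :
    ∀ t, 0 ≤ t → t ≤ T → ‖f t‖ ≤ A * ((C * t) ^ (m + 1) / (m + 1).factorial) := by
  intro t ht htT
  refine image_norm_le_of_norm_deriv_right_le_deriv_boundary (a := 0) (b := T) (f := f) (f' := f')
    (B := fun t => A * ((C * t) ^ (m + 1) / (m + 1).factorial))
    (B' := fun s => C * (A * ((C * s) ^ m / m.factorial)))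
    (fun s hs => ((hd s hs.1).continuousWithinAt).mono Set.Icc_subset_Ici_self)
    (fun s hs => (hd s hs.1).mono (Set.Ici_subset_Ici.2 hs.1)) (by simp [h0]) (fun s => ?_)
    (fun s hs => hb s hs.1 hs.2.le) ⟨ht, htT⟩
  refine (((((hasDerivAt_id s).const_mul C).pow (m + 1)).div_const
    ((m + 1).factorial : ℝ)).const_mul A).congr_deriv ?_
  have : (m.factorial : ℝ) ≠ 0 := by positivity
  rw [Nat.factorial_succ]
  push_cast
  simp only [id]
  field_simp

/-- Uniqueness for a hierarchy of third order equations under a geometric bound. -/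
lemma hierarchy_eq_zero {h : ℕ → ℕ → ℝ → ℂ} {p q s T M Q : ℝ} (hM : 0 ≤ M) (hQ : 0 ≤ Q)
    (hT : 0 ≤ T)
    (hd : ∀ k < 3, ∀ j t, 0 ≤ t → HasDerivWithinAt (h k j) (h (k + 1) j t) (Set.Ici 0) t)
    (heq : ∀ j t, 0 ≤ t → h 3 j t - p * h 2 (j + 1) t - h 1 (j + 1) t + q * h 1 (j + 2) t
      + s * h 0 (j + 2) t = 0)
    (h0 : ∀ k < 3, ∀ j, h k j 0 = 0)
    (hb : ∀ j t, 0 ≤ t → t ≤ T → ‖h 0 j t‖ ≤ M * Q ^ j) :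
    ∀ t, 0 ≤ t → t ≤ T → h 0 0 t = 0 := by
  set C₁ : ℝ := |s| * Q ^ 2 * T + Q + |q| * Q ^ 2 with hC₁
  set C : ℝ := C₁ * T + |p| * Q with hC
  have hC₁0 : 0 ≤ C₁ := by positivity
  have hC0 : 0 ≤ C := by positivity
  have key : ∀ m j t, 0 ≤ t → t ≤ T → ‖h 0 j t‖ ≤ M * Q ^ j * ((C * t) ^ m / m.factorial) := by
    intro m
    induction m with
    | zero => intro j t ht htT; simpa using hb j t ht htT
    | succ m ih =>
      intro j
      have hmono : ∀ u t, 0 ≤ u → u ≤ t →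
          (C * u) ^ m / m.factorial ≤ (C * t) ^ m / m.factorial := fun u t hu hut => by gcongr
      have hpos : ∀ t, 0 ≤ t → 0 ≤ (C * t) ^ m / m.factorial := fun t ht => by positivity
      -- Only `h 0` is bounded a priori. This combination is the first time integral of the
      -- equation: its derivative is `-s * h 0 (j + 2)`, free of time derivatives.
      have hD : ∀ t, 0 ≤ t → t ≤ T →
          ‖h 2 j t - p * h 1 (j + 1) t - h 0 (j + 1) t + q * h 0 (j + 2) t‖
            ≤ |s| * Q ^ 2 * T * (M * Q ^ j * ((C * t) ^ m / m.factorial)) := by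
        intro t ht htT
        have := norm_le_of_hasDerivWithinAt_Ici
          (f := fun t => h 2 j t - p * h 1 (j + 1) t - h 0 (j + 1) t + q * h 0 (j + 2) t)
          (f' := fun t => -(s * h 0 (j + 2) t))
          (A := |s| * (M * Q ^ (j + 2) * ((C * t) ^ m / m.factorial))) ht
          (by simp [h0]) (fun u hu => by
            refine ((((hd 2 (by norm_num) j u hu).sub
              ((hd 1 (by norm_num) (j + 1) u hu).const_mul (p : ℂ))).sub
              (hd 0 (by norm_num) (j + 1) u hu)).add
              ((hd 0 (by norm_num) (j + 2) u hu).const_mul (q : ℂ))).congr_deriv ?_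
            linear_combination heq j u hu)
          (fun u hu hut => by
            rw [norm_neg, norm_mul, Complex.norm_real, Real.norm_eq_abs]
            have h1 := ih (j + 2) u hu (hut.trans htT)
            have h2 := hmono u t hu hut
            gcongr
            exact h1.trans (by gcongr))
        refine this.trans ?_
        calc _ = |s| * Q ^ 2 * t * (M * Q ^ j * ((C * t) ^ m / m.factorial)) := by ring
          _ ≤ _ := by
            have := hpos t ht
            gcongr
      -- Second integration. As in the first, the factor t is wasted as T; only the third
      -- integration needs to raise the power of t.
      have he : ∀ t, 0 ≤ t → t ≤ T → ‖h 1 j t - p * h 0 (j + 1) t‖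
            ≤ C₁ * T * (M * Q ^ j * ((C * t) ^ m / m.factorial)) := by
        intro t ht htT
        have := norm_le_of_hasDerivWithinAt_Ici
          (f := fun t => h 1 j t - p * h 0 (j + 1) t)
          (f' := fun t => h 2 j t - p * h 1 (j + 1) t)
          (A := C₁ * (M * Q ^ j * ((C * t) ^ m / m.factorial))) ht
          (by simp [h0]) (fun u hu => (hd 1 (by norm_num) j u hu).sub
              ((hd 0 (by norm_num) (j + 1) u hu).const_mul (p : ℂ)))
          (fun u hu hut => by
            have e : h 2 j u - p * h 1 (j + 1) u
              = (h 2 j u - p * h 1 (j + 1) u - h 0 (j + 1) u + q * h 0 (j + 2) u)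
                + h 0 (j + 1) u - q * h 0 (j + 2) u := by ring
            have b1 := hD u hu (hut.trans htT)
            have b2 := ih (j + 1) u hu (hut.trans htT)
            have b3 := ih (j + 2) u hu (hut.trans htT)
            have b4 := hmono u t hu hut
            have b5 := hpos u hu
            rw [e]
            refine (norm_sub_le _ _).trans ((add_le_add (norm_add_le _ _) le_rfl).trans ?_)
            rw [norm_mul, Complex.norm_real, Real.norm_eq_abs]
            calc _ ≤ |s| * Q ^ 2 * T * (M * Q ^ j * ((C * u) ^ m / m.factorial))
                  + M * Q ^ (j + 1) * ((C * u) ^ m / m.factorial)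
                  + |q| * (M * Q ^ (j + 2) * ((C * u) ^ m / m.factorial)) := by gcongr
              _ = C₁ * (M * Q ^ j * ((C * u) ^ m / m.factorial)) := by rw [hC₁]; ring
              _ ≤ _ := by gcongr)
        refine this.trans ?_
        calc _ = C₁ * t * (M * Q ^ j * ((C * t) ^ m / m.factorial)) := by ring
          _ ≤ _ := by
            have := hpos t ht
            gcongr
      refine norm_le_pow_div_factorial m (h0 0 (by norm_num) j)
        (fun u hu => hd 0 (by norm_num) j u hu) fun u hu huT => ?_
      have e : h 1 j u = (h 1 j u - p * h 0 (j + 1) u) + p * h 0 (j + 1) u := by ring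
      have b2 := ih (j + 1) u hu huT
      rw [zero_add, e]
      refine (norm_add_le _ _).trans ?_
      rw [norm_mul, Complex.norm_real, Real.norm_eq_abs]
      calc _ ≤ C₁ * T * (M * Q ^ j * ((C * u) ^ m / m.factorial))
            + |p| * (M * Q ^ (j + 1) * ((C * u) ^ m / m.factorial)) := by
              gcongr; exact he u hu huT
        _ = _ := by rw [hC]; ring
  intro t ht htT
  have hlim := (FloorSemiring.tendsto_pow_div_factorial_atTop (C * t)).const_mul (M * Q ^ 0)
  rw [mul_zero] at hlim
  have := ge_of_tendsto' hlim fun m => key m 0 t ht htT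
  exact norm_le_zero_iff.1 this

lemma fourierInv_iterate_laplacian_apply (φ : 𝓢(Rn n, ℂ)) (j : ℕ) (ξ : Rn n) :
    (𝓕⁻ ((fun φ : 𝓢(Rn n, ℂ) => Δ φ)^[j] φ)) ξ
      = (-((2 * π * ‖ξ‖ : ℝ) : ℂ) ^ 2) ^ j * (𝓕⁻ φ) ξ := by
  induction j with
  | zero => simp
  | succ j ih => rw [Function.iterate_succ_apply', fourierInv_laplacian_apply, ih]; ring

/-- On the Fourier side each Laplacian multiplies by -(2π|ξ|)², bounded by (2πR)² on the support of
g. The inequality xy ≤ x² + y² replaces Cauchy–Schwarz, since only the geometric growth in j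
matters. -/
lemma norm_pairing_iterate_laplacian_le (u : Lp ℂ 2 (volume : Measure (Rn n)))
    {g : 𝓢(Rn n, ℂ)} {R : ℝ} (hg : ∀ ξ, R < ‖ξ‖ → g ξ = 0) (j : ℕ) :
    ‖pairing u ((fun φ : 𝓢(Rn n, ℂ) => Δ φ)^[j] (𝓕 g))‖
      ≤ (‖u‖ ^ 2 + ∫ ξ, ‖g ξ‖ ^ 2) * ((2 * π * R) ^ 2) ^ j := by
  rw [pairing_eq_integral_fourier]
  simp only [fourierInv_iterate_laplacian_apply, FourierTransform.fourierInv_fourier_eq]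
  set v : Lp ℂ 2 (volume : Measure (Rn n)) := 𝓕 u with hv
  have hn : ‖u‖ ^ 2 = ∫ ξ, ‖v ξ‖ ^ 2 := by
    rw [← Lp.norm_fourier_eq u, ← hv, ← normL2_sq (Lp.memLp v), normL2, Lp.norm_def]
  have i1 : Integrable fun ξ => ‖v ξ‖ ^ 2 := (Lp.memLp v).integrable_norm_pow (by norm_num)
  have i2 : Integrable fun ξ => ‖g ξ‖ ^ 2 := (g.memLp 2).integrable_norm_pow (by norm_num)
  rw [hn, ← integral_add i1 i2, ← integral_mul_const]
  refine norm_integral_le_of_norm_le ((i1.add i2).mul_const _) (.of_forall fun ξ => ?_)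
  rcases lt_or_ge R ‖ξ‖ with hR | hR
  · rw [hg ξ hR]; simp; positivity
  · rw [norm_mul, norm_mul, norm_pow, norm_neg, norm_pow, Complex.norm_real,
      Real.norm_of_nonneg (by positivity)]
    have h1 : ‖v ξ‖ * ‖g ξ‖ ≤ ‖v ξ‖ ^ 2 + ‖g ξ‖ ^ 2 := by
      nlinarith [sq_nonneg (‖v ξ‖ - ‖g ξ‖), sq_nonneg ‖v ξ‖, sq_nonneg ‖g ξ‖]
    calc _ = (‖v ξ‖ * ‖g ξ‖) * ((2 * π * ‖ξ‖) ^ 2) ^ j := by ring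
      _ ≤ _ := by gcongr

section
variable {b ν κ γ : ℝ} {ψ₀ ψ₁ ψ₂ : Rn n → ℂ} {ψ χ : ℝ → Lp ℂ 2 (volume : Measure (Rn n))}

lemma IsSolution.hasDerivWithinAt_dtPairing (h : IsSolution b ν κ γ ψ₀ ψ₁ ψ₂ ψ) {k : ℕ}
    (hk : k < 3) (φ : 𝓢(Rn n, ℂ)) {t : ℝ} (ht : 0 ≤ t) :
    HasDerivWithinAt (dtPairing k ψ φ) (dtPairing (k + 1) ψ φ t) (Set.Ici 0) t := by
  have hd := (h.contDiffOn φ).differentiableOn_iteratedDerivWithin (m := k)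
    (by exact_mod_cast hk) (uniqueDiffOn_Ici 0) t ht
  have := hd.hasDerivWithinAt
  rwa [← iteratedDerivWithin_succ] at this

lemma IsSolution.continuousOn_dtPairing (h : IsSolution b ν κ γ ψ₀ ψ₁ ψ₂ ψ) {k : ℕ}
    (hk : k ≤ 3) (φ : 𝓢(Rn n, ℂ)) : ContinuousOn (dtPairing k ψ φ) (Set.Ici 0) :=
  (h.contDiffOn φ).continuousOn_iteratedDerivWithin (by exact_mod_cast hk) (uniqueDiffOn_Ici 0)

lemma IsSolution.equation_of_nonneg (h : IsSolution b ν κ γ ψ₀ ψ₁ ψ₂ ψ) (φ : 𝓢(Rn n, ℂ))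
    {t : ℝ} (ht : 0 ≤ t) :
    dtPairing 3 ψ φ t
      - ((soundDiffusivity b ν κ γ + κ : ℝ) : ℂ) * dtPairing 2 ψ (Δ φ) t
      - dtPairing 1 ψ (Δ φ) t
      + ((κ * soundDiffusivity b ν κ γ + κ * (γ - 1) * (b * ν - κ) : ℝ) : ℂ)
          * dtPairing 1 ψ (Δ (Δ φ)) t
      + (κ : ℂ) * dtPairing 0 ψ (Δ (Δ φ)) t = 0 := by
  have hc := fun φ {k} (hk : k ≤ 3) => h.continuousOn_dtPairing hk φ
  refine Set.EqOn.of_subset_closure (s := Set.Ioi 0) (t := Set.Ici 0)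
    (f := fun t => dtPairing 3 ψ φ t
      - ((soundDiffusivity b ν κ γ + κ : ℝ) : ℂ) * dtPairing 2 ψ (Δ φ) t
      - dtPairing 1 ψ (Δ φ) t
      + ((κ * soundDiffusivity b ν κ γ + κ * (γ - 1) * (b * ν - κ) : ℝ) : ℂ)
          * dtPairing 1 ψ (Δ (Δ φ)) t
      + (κ : ℂ) * dtPairing 0 ψ (Δ (Δ φ)) t) (g := fun _ => 0)
    (fun t ht => h.equation φ t ht) ?_ continuousOn_const Set.Ioi_subset_Ici_self
    (by rw [closure_Ioi]) ht
  exact ((((hc _ le_rfl).sub (continuousOn_const.mul (hc _ (by norm_num)))).sub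
    (hc _ (by norm_num))).add (continuousOn_const.mul (hc _ (by norm_num)))).add
    (continuousOn_const.mul (hc _ (by norm_num)))

/-- The equation holds only weakly, so no ODE at fixed ξ is at hand. Testing against Δ^j 𝓕 g with g
of compact support gives instead a closed hierarchy in j, and such g determine the transform of the
solution. -/
theorem IsSolution.eq (hχ : IsSolution b ν κ γ ψ₀ ψ₁ ψ₂ χ) (hψ : IsSolution b ν κ γ ψ₀ ψ₁ ψ₂ ψ)
    {T : ℝ} (hT : 0 ≤ T) : χ T = ψ T := by
  have hinj : Function.Injective (𝓕 : Lp ℂ 2 (volume : Measure (Rn n)) → Lp ℂ 2 volume) :=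
    (Lp.fourierTransformₗᵢ (Rn n) ℂ).injective
  refine hinj (Lp.ext (ae_eq_of_integral_schwartz
    ((Lp.memLp _).locallyIntegrable (by norm_num)) ((Lp.memLp _).locallyIntegrable (by norm_num))
    fun g hg => ?_))
  obtain ⟨R, hR⟩ := hg.isCompact.isBounded.exists_norm_le
  have hgR : ∀ ξ, R < ‖ξ‖ → g ξ = 0 := fun ξ hξ => by
    by_contra hne
    exact (hR ξ (subset_tsupport _ hne)).not_gt hξ
  have hpair : ∀ (u : Lp ℂ 2 (volume : Measure (Rn n))),
      ∫ ξ, (𝓕 u : Lp ℂ 2 (volume : Measure (Rn n))) ξ * g ξ = pairing u (𝓕 g) := fun u => by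
    rw [pairing_eq_integral_fourier, FourierTransform.fourierInv_fourier_eq]
  rw [hpair, hpair, ← sub_eq_zero]
  obtain ⟨M₁, hM₁⟩ := isCompact_Icc.exists_bound_of_continuousOn
    (hχ.continuousOn.mono (show Set.Icc 0 T ⊆ Set.Ici 0 from Set.Icc_subset_Ici_self))
  obtain ⟨M₂, hM₂⟩ := isCompact_Icc.exists_bound_of_continuousOn
    (hψ.continuousOn.mono (show Set.Icc 0 T ⊆ Set.Ici 0 from Set.Icc_subset_Ici_self))
  set φ : ℕ → 𝓢(Rn n, ℂ) := fun j => (fun φ : 𝓢(Rn n, ℂ) => Δ φ)^[j] (𝓕 g) with hφ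
  have hφs : ∀ j, φ (j + 1) = Δ (φ j) := fun j => Function.iterate_succ_apply' _ _ _
  set I := ∫ ξ, ‖g ξ‖ ^ 2 with hI
  have hI0 : 0 ≤ I := integral_nonneg fun _ => by positivity
  have h00 : ∀ (u : ℝ → Lp ℂ 2 (volume : Measure (Rn n))) φ t,
      dtPairing 0 u φ t = pairing (u t) φ := fun u φ t => by
    simp [dtPairing]
  have := hierarchy_eq_zero (h := fun k j t => dtPairing k χ (φ j) t - dtPairing k ψ (φ j) t)
    (p := soundDiffusivity b ν κ γ + κ)
    (q := κ * soundDiffusivity b ν κ γ + κ * (γ - 1) * (b * ν - κ)) (s := κ) (T := T)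
    (M := (M₁ ^ 2 + I) + (M₂ ^ 2 + I)) (Q := (2 * π * R) ^ 2) (by positivity) (by positivity) hT
    (fun k hk j t ht => (hχ.hasDerivWithinAt_dtPairing hk (φ j) ht).sub
      (hψ.hasDerivWithinAt_dtPairing hk (φ j) ht))
    (fun j t ht => by
      have e1 := hχ.equation_of_nonneg (φ j) ht
      have e2 := hψ.equation_of_nonneg (φ j) ht
      simp only [show j + 2 = (j + 1) + 1 from rfl, hφs]
      linear_combination e1 - e2)
    (fun k hk j => by
      interval_cases k
      · simp only [hχ.init_zero, hψ.init_zero, sub_self]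
      · simp only [hχ.init_one, hψ.init_one, sub_self]
      · simp only [hχ.init_two, hψ.init_two, sub_self])
    (fun j t ht htT => by
      simp only [h00]
      refine (norm_sub_le _ _).trans ?_
      rw [add_mul]
      have b1 := hM₁ t ⟨ht, htT⟩
      have b2 := hM₂ t ⟨ht, htT⟩
      refine add_le_add ((norm_pairing_iterate_laplacian_le _ hgR j).trans ?_)
        ((norm_pairing_iterate_laplacian_le _ hgR j).trans ?_) <;> gcongr)
    T hT le_rfl
  simp only [h00] at this
  exact this

end

/-! ### Integrals over low frequencies -/

lemma exp_neg_le_rpow {c s : ℝ} (hc : 0 < c) (hs : 0 < s) :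
    ∃ C : ℝ, 0 < C ∧ ∀ t, 0 ≤ t → Real.exp (-c * t) ≤ C * (1 + t) ^ (-s) := by
  refine ⟨(s / c) ^ s * Real.exp c, by positivity, fun t ht => ?_⟩
  -- The inequality x ≤ e^x at x = (c/s)(1+t); raising it to the power s gives the claim.
  have h1 : 1 + t ≤ s / c * Real.exp (c / s * (1 + t)) := by
    have h2 := Real.add_one_le_exp (c / s * (1 + t))
    calc 1 + t = s / c * (c / s * (1 + t)) := by field_simp
      _ ≤ _ := by gcongr; linarith
  have h3 : (1 + t) ^ s ≤ (s / c) ^ s * Real.exp c * Real.exp (c * t) := by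
    calc (1 + t) ^ s ≤ (s / c * Real.exp (c / s * (1 + t))) ^ s := by gcongr
      _ = (s / c) ^ s * Real.exp (c * (1 + t)) := by
        rw [Real.mul_rpow (by positivity) (by positivity), ← Real.exp_mul]
        congr 2; field_simp
      _ = _ := by rw [mul_assoc, ← Real.exp_add]; ring_nf
  rw [Real.rpow_neg (by positivity), neg_mul, Real.exp_neg, ← div_eq_mul_inv,
    le_div_iff₀ (by positivity), inv_mul_le_iff₀ (Real.exp_pos _)]
  linarith

lemma gaussian_moment {n : ℕ} (hn : 1 ≤ n) {m : ℝ} (hm : -(n : ℝ) < m) :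
    ∃ C : ℝ, 0 < C ∧ ∀ b : ℝ, 0 < b →
      Integrable (fun ξ : Rn n => ‖ξ‖ ^ m * Real.exp (-b * ‖ξ‖ ^ 2)) ∧
      ∫ ξ : Rn n, ‖ξ‖ ^ m * Real.exp (-b * ‖ξ‖ ^ 2) ≤ C * b ^ (-((n : ℝ) + m) / 2) := by
  have : Nonempty (Fin n) := ⟨⟨0, hn⟩⟩
  have hfun : ∀ b : ℝ, Set.EqOn (fun y : ℝ => y ^ (n - 1) • (y ^ m * Real.exp (-b * y ^ 2)))
      (fun y => y ^ ((n : ℝ) - 1 + m) * Real.exp (-b * y ^ (2 : ℝ))) (Set.Ioi 0) := by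
    intro b y (hy : 0 < y)
    simp only [smul_eq_mul]
    rw [← mul_assoc, ← Real.rpow_natCast, ← Real.rpow_add hy, Nat.cast_sub hn, Real.rpow_two,
      Nat.cast_one]
  set V := (volume : Measure (Rn n)).real (Metric.ball 0 1)
  have hV : 0 ≤ V := ENNReal.toReal_nonneg
  set G := 1 / 2 * Real.Gamma (((n : ℝ) - 1 + m + 1) / 2)
  have hG : 0 < G := mul_pos (by norm_num) (Real.Gamma_pos_of_pos (by linarith))
  refine ⟨n * (V * G) + 1, by positivity, fun b hb => ⟨?_, ?_⟩⟩
  · refine (integrable_fun_norm_addHaar (volume : Measure (Rn n))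
      (f := fun y => y ^ m * Real.exp (-b * y ^ 2))).2 ?_
    rw [finrank_euclideanSpace_fin, integrableOn_congr_fun (hfun b) measurableSet_Ioi]
    exact integrableOn_rpow_mul_exp_neg_mul_rpow (by linarith) (by norm_num) hb
  · rw [integral_fun_norm_addHaar (volume : Measure (Rn n))
      (fun y => y ^ m * Real.exp (-b * y ^ 2)), finrank_euclideanSpace_fin,
      setIntegral_congr_fun measurableSet_Ioi (hfun b),
      integral_rpow_mul_exp_neg_mul_rpow (by norm_num) (by linarith) hb, nsmul_eq_mul, smul_eq_mul]
    have e : (-((n : ℝ) - 1 + m + 1) / 2) = -((n : ℝ) + m) / 2 := by ring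
    rw [e]
    have : 0 ≤ b ^ (-((n : ℝ) + m) / 2) := by positivity
    calc _ = n * (V * G) * b ^ (-((n : ℝ) + m) / 2) := by ring
      _ ≤ _ := by gcongr; linarith

lemma gaussian_weight {n : ℕ} (hn : 1 ≤ n) {m c C : ℝ} (hm : -(n : ℝ) < m) (hc : 0 < c)
    (hC : 0 < C) :
    ∃ D : ℝ, 0 < D ∧ ∀ t : ℝ, 0 ≤ t →
      Integrable (fun ξ : Rn n =>
        C * ((2 * π * ‖ξ‖) ^ m * Real.exp (-c * (1 + t) * (2 * π * ‖ξ‖) ^ 2))) ∧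
      ∫ ξ : Rn n, C * ((2 * π * ‖ξ‖) ^ m * Real.exp (-c * (1 + t) * (2 * π * ‖ξ‖) ^ 2))
        ≤ D * (1 + t) ^ (-((n : ℝ) + m) / 2) := by
  obtain ⟨D, hD, h⟩ := gaussian_moment hn hm
  have hπ := Real.two_pi_pos
  refine ⟨C * (2 * π) ^ m * D * (c * (2 * π) ^ 2) ^ (-((n : ℝ) + m) / 2), by positivity,
    fun t ht => ?_⟩
  have hfun : (fun ξ : Rn n =>
        C * ((2 * π * ‖ξ‖) ^ m * Real.exp (-c * (1 + t) * (2 * π * ‖ξ‖) ^ 2)))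
      = fun ξ => C * (2 * π) ^ m * (‖ξ‖ ^ m
        * Real.exp (-(c * (2 * π) ^ 2 * (1 + t)) * ‖ξ‖ ^ 2)) := by
    ext ξ
    rw [Real.mul_rpow hπ.le (norm_nonneg _)]
    ring_nf
  rw [hfun]
  obtain ⟨h1, h2⟩ := h (c * (2 * π) ^ 2 * (1 + t)) (by positivity)
  refine ⟨h1.const_mul _, ?_⟩
  rw [integral_const_mul]
  rw [Real.mul_rpow (by positivity) (by positivity)] at h2
  calc _ ≤ C * (2 * π) ^ m * (D * ((c * (2 * π) ^ 2) ^ (-((n : ℝ) + m) / 2)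
        * (1 + t) ^ (-((n : ℝ) + m) / 2))) := by gcongr
    _ = _ := by ring

/-- The low frequency weight for the third datum in dimensions three and four. -/
noncomputable def singularWeight (T y : ℝ) : ℝ := T ^ 2 / (y ^ 2 * (1 + T ^ 2 * y ^ 2))

/-- In polar coordinates the volume factor y^(n-1) cancels the singularity y⁻² as soon as n ≥ 3,
which leaves a continuous radial integrand with primitive F. -/
lemma integral_singularWeight_ball {n : ℕ} (hn : 3 ≤ n) {T A : ℝ} {F : ℝ → ℝ}
    (hF : ∀ y, HasDerivAt F (y ^ (n - 3) * (T ^ 2 / (1 + T ^ 2 * y ^ 2))) y)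
    (hA : F 1 - F 0 ≤ A) :
    IntegrableOn (fun ξ : Rn n => singularWeight T ‖ξ‖) (Metric.ball 0 1) ∧
      ∫ ξ in Metric.ball (0 : Rn n) 1, singularWeight T ‖ξ‖
        ≤ n * (volume : Measure (Rn n)).real (Metric.ball 0 1) * A := by
  have : Nonempty (Fin n) := ⟨⟨0, by omega⟩⟩
  have hfun : Set.EqOn (fun y : ℝ => y ^ (n - 1) • singularWeight T y)
      (fun y => y ^ (n - 3) * (T ^ 2 / (1 + T ^ 2 * y ^ 2))) (Set.Ioo 0 1) := by
    intro y hy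
    have hy0 : 0 < y := hy.1
    have e : y ^ (n - 1) = y ^ (n - 3) * y ^ 2 := by rw [← pow_add]; congr 1; omega
    simp only [smul_eq_mul, singularWeight]
    rw [e]
    field_simp
  have hcont : Continuous fun y : ℝ => y ^ (n - 3) * (T ^ 2 / (1 + T ^ 2 * y ^ 2)) := by
    refine (continuous_pow _).mul (continuous_const.div (by fun_prop) fun y => ?_)
    positivity
  have hint : IntegrableOn (fun y : ℝ => y ^ (n - 3) * (T ^ 2 / (1 + T ^ 2 * y ^ 2)))
      (Set.Ioo 0 1) := hcont.integrableOn_Icc.mono_set Set.Ioo_subset_Icc_self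
  constructor
  · rw [integrableOn_fun_norm_addHaar, finrank_euclideanSpace_fin,
      integrableOn_congr_fun hfun measurableSet_Ioo]
    exact hint
  · have h1 : ∫ ξ in Metric.ball (0 : Rn n) 1, singularWeight T ‖ξ‖
        = ∫ ξ : Rn n, (Set.Iio 1).indicator (singularWeight T) ‖ξ‖ := by
      rw [← integral_indicator measurableSet_ball]
      refine integral_congr_ae (.of_forall fun ξ => ?_)
      by_cases h : ‖ξ‖ < 1 <;> simp [Set.indicator, h]
    have h2 : ∫ y in Set.Ioi (0 : ℝ), y ^ (n - 1) • (Set.Iio 1).indicator (singularWeight T) y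
        = F 1 - F 0 := by
      have e : (fun y : ℝ => y ^ (n - 1) • (Set.Iio 1).indicator (singularWeight T) y)
          = (Set.Iio 1).indicator fun y => y ^ (n - 1) • singularWeight T y := by
        ext y; by_cases h : y < 1 <;> simp [Set.indicator, h]
      rw [e, setIntegral_indicator measurableSet_Iio, Set.Ioi_inter_Iio,
        setIntegral_congr_fun measurableSet_Ioo hfun, ← integral_Ioc_eq_integral_Ioo,
        ← intervalIntegral.integral_of_le zero_le_one]
      exact intervalIntegral.integral_eq_sub_of_hasDerivAt (fun y _ => hF y)
        (hcont.intervalIntegrable _ _)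
    rw [h1, integral_fun_norm_addHaar, finrank_euclideanSpace_fin, h2, nsmul_eq_mul, smul_eq_mul,
      mul_assoc]
    have : 0 ≤ (volume : Measure (Rn n)).real (Metric.ball 0 1) := ENNReal.toReal_nonneg
    gcongr

lemma singularWeight_three : ∃ C : ℝ, 0 < C ∧ ∀ t : ℝ, 0 ≤ t →
    IntegrableOn (fun ξ : Rn 3 => singularWeight (1 + t) ‖ξ‖) (Metric.ball 0 1) ∧
      ∫ ξ in Metric.ball (0 : Rn 3) 1, singularWeight (1 + t) ‖ξ‖
        ≤ C * weightDTilde 3 t ^ 2 := by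
  set V := (volume : Measure (Rn 3)).real (Metric.ball 0 1) with hV
  have hV0 : 0 ≤ V := ENNReal.toReal_nonneg
  refine ⟨3 * V * (π / 2) + 1, by positivity, fun t ht => ?_⟩
  obtain ⟨h1, h2⟩ := integral_singularWeight_ball (n := 3) le_rfl (T := 1 + t)
    (A := (1 + t) * (π / 2))
    (F := fun y => (1 + t) * Real.arctan ((1 + t) * y)) (fun y => by
      refine ((((hasDerivAt_id y).const_mul (1 + t)).arctan).const_mul (1 + t)).congr_deriv ?_
      simp only [id]
      field_simp
      ring) (by
      simp only [mul_zero, Real.arctan_zero, sub_zero]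
      have := (Real.arctan_lt_pi_div_two ((1 + t) * 1)).le
      gcongr)
  refine ⟨h1, h2.trans ?_⟩
  have e : weightDTilde 3 t ^ 2 = 1 + t := by
    rw [weightDTilde, if_pos le_rfl, ← Real.rpow_natCast, ← Real.rpow_mul (by linarith)]
    norm_num
  rw [e, ← hV]
  push_cast
  nlinarith

lemma singularWeight_four : ∃ C : ℝ, 0 < C ∧ ∀ t : ℝ, 0 ≤ t →
    IntegrableOn (fun ξ : Rn 4 => singularWeight (1 + t) ‖ξ‖) (Metric.ball 0 1) ∧
      ∫ ξ in Metric.ball (0 : Rn 4) 1, singularWeight (1 + t) ‖ξ‖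
        ≤ C * weightDTilde 4 t ^ 2 := by
  set V := (volume : Measure (Rn 4)).real (Metric.ball 0 1) with hV
  have hV0 : 0 ≤ V := ENNReal.toReal_nonneg
  refine ⟨4 * V + 1, by positivity, fun t ht => ?_⟩
  have hE : 2 < Real.exp 1 := by linarith [Real.exp_one_gt_d9]
  have hlog : 0 ≤ Real.log (Real.exp 1 + t) := Real.log_nonneg (by linarith)
  obtain ⟨h1, h2⟩ := integral_singularWeight_ball (n := 4) (by norm_num) (T := 1 + t)
    (A := Real.log (Real.exp 1 + t))
    (F := fun y => 1 / 2 * Real.log (1 + (1 + t) ^ 2 * y ^ 2)) (fun y => by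
      have hne : 1 + (1 + t) ^ 2 * y ^ 2 ≠ 0 := by positivity
      refine ((((((hasDerivAt_id y).pow 2).const_mul ((1 + t) ^ 2)).const_add 1).log
        hne).const_mul (1 / 2)).congr_deriv ?_
      simp only [id]
      field_simp
      norm_num
      rw [mul_div_assoc, div_self hne, mul_one]) (by
      simp only [ne_eq, OfNat.ofNat_ne_zero, not_false_eq_true, zero_pow, mul_zero, add_zero,
        Real.log_one, sub_zero, one_pow, mul_one]
      -- Bounding by a square lets the logarithm's factor 2 cancel the 1/2 in the primitive.
      have h3 : Real.log (1 + (1 + t) ^ 2) ≤ Real.log ((Real.exp 1 + t) ^ 2) := by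
        apply Real.log_le_log (by positivity)
        nlinarith
      rw [Real.log_pow] at h3
      push_cast at h3
      linarith)
  refine ⟨h1, h2.trans ?_⟩
  have e : weightDTilde 4 t ^ 2 = Real.log (Real.exp 1 + t) := by
    rw [weightDTilde, if_neg (by norm_num), if_pos rfl, ← Real.rpow_natCast,
      ← Real.rpow_mul hlog]
    norm_num
  rw [e, ← hV]
  push_cast
  nlinarith

/-! ### From kernel bounds to the L² estimate -/

section
variable {a κ γ : ℝ}

lemma kernel_sq_low (ha : 0 < a) (hκ : 0 < κ) (hγ : 1 < γ) :
    ∃ c C : ℝ, 0 < c ∧ 0 < C ∧ ∀ (j : Fin 3) (r t : ℝ), 0 < r → r ≤ 1 → 0 ≤ t →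
      kernel a κ γ 0 j t r ^ 2
        ≤ C * (r ^ (-2 * (j : ℝ)) * Real.exp (-c * (1 + t) * r ^ 2)) := by
  obtain ⟨c, C, hc, hC, h⟩ := kernel_sq_le a κ γ ha hκ hγ
  -- For r ≤ 1 one has r²/(1+r²) ≥ r²/2, which halves the rate; the factor exp(c/2) pays for
  -- replacing t by 1 + t, and 4 = 2² covers j ≤ 2.
  refine ⟨c / 2, C * 4 * Real.exp (c / 2), by positivity, by positivity,
    fun j r t hr hr1 ht => (h j r t hr ht).trans ?_⟩
  have hr2 : r ^ 2 ≤ 1 := pow_le_one₀ hr.le hr1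
  have h1 : (1 + 1 / r ^ 2) ^ (j : ℕ) ≤ 4 * r ^ (-2 * (j : ℝ)) := by
    have e : r ^ (-2 * (j : ℝ)) = (1 / r ^ 2) ^ (j : ℕ) := by
      rw [Real.rpow_mul hr.le, Real.rpow_natCast, Real.rpow_neg hr.le, Real.rpow_two, one_div]
    have h2 : 1 ≤ 1 / r ^ 2 := by rw [le_div_iff₀ (by positivity)]; linarith
    rw [e]
    calc _ ≤ (2 * (1 / r ^ 2)) ^ (j : ℕ) := by gcongr; linarith
      _ = 2 ^ (j : ℕ) * (1 / r ^ 2) ^ (j : ℕ) := mul_pow _ _ _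
      _ ≤ 2 ^ 2 * (1 / r ^ 2) ^ (j : ℕ) := by
        gcongr
        · norm_num
        · omega
      _ = _ := by norm_num
  have h2 : Real.exp (-c * (r ^ 2 / (1 + r ^ 2)) * t)
      ≤ Real.exp (c / 2) * Real.exp (-(c / 2) * (1 + t) * r ^ 2) := by
    rw [← Real.exp_add, Real.exp_le_exp]
    have h3 : r ^ 2 / 2 ≤ r ^ 2 / (1 + r ^ 2) := by gcongr; linarith
    have h4 : c * (r ^ 2 / 2) * t ≤ c * (r ^ 2 / (1 + r ^ 2)) * t := by gcongr
    have h5 : c / 2 * r ^ 2 ≤ c / 2 * 1 := by gcongr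
    linarith
  calc _ ≤ C * (4 * r ^ (-2 * (j : ℝ)))
        * (Real.exp (c / 2) * Real.exp (-(c / 2) * (1 + t) * r ^ 2)) := by gcongr
    _ = _ := by ring

lemma kernel_sq_high (ha : 0 < a) (hκ : 0 < κ) (hγ : 1 < γ) :
    ∃ c C : ℝ, 0 < c ∧ 0 < C ∧ ∀ (j : Fin 3) (r t : ℝ), 1 ≤ r → 0 ≤ t →
      kernel a κ γ 0 j t r ^ 2 ≤ C ^ 2 * Real.exp (-c * t) ^ 2 := by
  obtain ⟨c, C, hc, hC, h⟩ := kernel_sq_le a κ γ ha hκ hγ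
  -- One factor 1/2 comes from r²/(1+r²) ≥ 1/2, the other from writing the exponential as a square.
  refine ⟨c / 4, √(C * 4), by positivity, by positivity,
    fun j r t hr ht => (h j r t (by linarith) ht).trans ?_⟩
  rw [Real.sq_sqrt (by positivity), ← Real.exp_nat_mul]
  have hr2 : 1 ≤ r ^ 2 := one_le_pow₀ hr
  have h1 : (1 + 1 / r ^ 2) ^ (j : ℕ) ≤ 4 := by
    have h2 : 1 / r ^ 2 ≤ 1 := by rw [div_le_one (by positivity)]; exact hr2
    calc (1 + 1 / r ^ 2) ^ (j : ℕ) ≤ (2 : ℝ) ^ (j : ℕ) := by gcongr; linarith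
      _ ≤ 2 ^ 2 := pow_le_pow_right₀ (by norm_num) (by omega)
      _ = 4 := by norm_num
  have h2 : 1 / 2 ≤ r ^ 2 / (1 + r ^ 2) := by
    rw [div_le_div_iff₀ (by norm_num) (by positivity)]; linarith
  have h3 : c * (1 / 2) * t ≤ c * (r ^ 2 / (1 + r ^ 2)) * t := by gcongr
  have h4 : Real.exp (-c * (r ^ 2 / (1 + r ^ 2)) * t)
      ≤ Real.exp (((2 : ℕ) : ℝ) * (-(c / 4) * t)) := by
    rw [Real.exp_le_exp]
    push_cast
    linarith
  gcongr

/-- The singular weight is comparable to the minimum of y⁻⁴ and T²y⁻², so it combines the energy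
bound with the bound t/r. It decreases in y, hence the freedom y ≤ r, later used with y = |ξ| and r
= 2π|ξ|. -/
lemma kernel_two_sq_low (ha : 0 < a) (hκ : 0 < κ) (hγ : 1 < γ) :
    ∃ C : ℝ, 0 < C ∧ ∀ (r y t : ℝ), 0 < y → y ≤ r → r ≤ 1 → 0 ≤ t →
      kernel a κ γ 0 2 t r ^ 2 ≤ C * singularWeight (1 + t) y := by
  obtain ⟨c, C, hc, hC, h⟩ := kernel_sq_low ha hκ hγ
  obtain ⟨D, hD, h'⟩ := kernel_two_le a κ γ ha hκ hγ
  refine ⟨C + D ^ 2, by positivity, fun r y t hy hyr hr1 ht => ?_⟩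
  have hr : 0 < r := by linarith
  set T := 1 + t with hT
  have hT0 : 0 < T := by linarith
  set K := kernel a κ γ 0 2 t r
  have h1 : K ^ 2 ≤ C / r ^ 4 := by
    refine (h 2 r t hr hr1 ht).trans ?_
    have e1 : r ^ (-2 * (((2 : Fin 3) : ℕ) : ℝ)) = 1 / r ^ 4 := by
      rw [show -2 * (((2 : Fin 3) : ℕ) : ℝ) = -((4 : ℕ) : ℝ) by norm_num, Real.rpow_neg hr.le,
        Real.rpow_natCast, one_div]
    have e2 : Real.exp (-c * (1 + t) * r ^ 2) ≤ 1 := by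
      rw [Real.exp_le_one_iff]
      have : 0 ≤ c * (1 + t) * r ^ 2 := by positivity
      linarith
    rw [e1]
    calc _ ≤ C * (1 / r ^ 4 * 1) := by gcongr
      _ = _ := by ring
  have h2 : K ^ 2 ≤ D ^ 2 * T ^ 2 / r ^ 2 := by
    have := h' r t hr hr1 ht
    rw [← sq_abs]
    calc _ ≤ (D * t / r) ^ 2 := by gcongr
      _ ≤ (D * T / r) ^ 2 := by gcongr; linarith
      _ = _ := by ring
  have h3 : K ^ 2 * (r ^ 2 * (1 + T ^ 2 * r ^ 2)) ≤ (C + D ^ 2) * T ^ 2 := by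
    rw [le_div_iff₀ (by positivity)] at h1 h2
    have := mul_le_mul_of_nonneg_right h1 (sq_nonneg T)
    linarith
  have h4 : y ^ 2 * (1 + T ^ 2 * y ^ 2) ≤ r ^ 2 * (1 + T ^ 2 * r ^ 2) := by gcongr
  unfold singularWeight
  rw [← mul_div_assoc, le_div_iff₀ (by positivity)]
  exact (mul_le_mul_of_nonneg_left h4 (sq_nonneg K)).trans h3

/-- `w` bounds, up to a constant, the `L²` norm over low frequencies of `r ↦ r ^ i * K_j(t, r)`. -/
def LowFrequencyBound (n : ℕ) (a κ γ : ℝ) (j : Fin 3) (i : ℕ) (w : ℝ → ℝ) : Prop :=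
  ∃ D : ℝ, 0 < D ∧ ∀ t, 0 ≤ t → ∃ g : Rn n → ℝ, Integrable g ∧ (∀ ξ, 0 ≤ g ξ) ∧
    (∀ ξ, 0 < ‖ξ‖ → 2 * π * ‖ξ‖ ≤ 1 →
      ((2 * π * ‖ξ‖) ^ i * kernel a κ γ 0 j t (2 * π * ‖ξ‖)) ^ 2 ≤ g ξ) ∧
    ∫ ξ, g ξ ≤ (D * w t) ^ 2

/-- The squared quantity is a Gaussian moment of order 2i - 2j, convergent exactly when n + 2i - 2j
> 0; 4s is this number, a factor 2 coming from the scaling and another from the square root. -/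
lemma lowFrequencyBound_of_lt {n : ℕ} (hn : 1 ≤ n) (ha : 0 < a) (hκ : 0 < κ) (hγ : 1 < γ)
    (j : Fin 3) (i : ℕ) {s : ℝ} (hs : 0 < s) (hsj : 4 * s = n + 2 * i - 2 * (j : ℝ)) :
    LowFrequencyBound n a κ γ j i fun t => (1 + t) ^ (-s) := by
  obtain ⟨c, C, hc, hC, h⟩ := kernel_sq_low ha hκ hγ
  obtain ⟨D, hD, hg⟩ := gaussian_weight (n := n) hn (m := 2 * (i : ℝ) - 2 * (j : ℝ)) (c := c)
    (C := C) (by linarith) hc hC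
  refine ⟨√D, by positivity, fun t ht => ⟨_, (hg t ht).1, fun ξ => by positivity,
    fun ξ hξ hξ1 => ?_, (hg t ht).2.trans (le_of_eq ?_)⟩⟩
  · set r := 2 * π * ‖ξ‖ with hr
    have hr0 : 0 < r := by positivity
    have := h j r t hr0 hξ1 ht
    rw [mul_pow]
    have e : r ^ (2 * (i : ℝ) - 2 * (j : ℝ)) = (r ^ i) ^ 2 * r ^ (-2 * (j : ℝ)) := by
      rw [sub_eq_add_neg, Real.rpow_add hr0, mul_comm (2 : ℝ), Real.rpow_mul hr0.le,
        Real.rpow_natCast, Real.rpow_two, neg_mul]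
    rw [e]
    calc _ ≤ (r ^ i) ^ 2 * (C * (r ^ (-2 * (j : ℝ)) * Real.exp (-c * (1 + t) * r ^ 2))) := by
          gcongr
      _ = _ := by ring
  · rw [mul_pow, Real.sq_sqrt hD.le, ← Real.rpow_natCast ((1 + t) ^ (-s)),
      ← Real.rpow_mul (by linarith)]
    congr 2
    push_cast
    linarith

lemma lowFrequencyBound_singular {n : ℕ} (ha : 0 < a) (hκ : 0 < κ) (hγ : 1 < γ)
    (h : ∃ C : ℝ, 0 < C ∧ ∀ t : ℝ, 0 ≤ t →
      IntegrableOn (fun ξ : Rn n => singularWeight (1 + t) ‖ξ‖) (Metric.ball 0 1) ∧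
      ∫ ξ in Metric.ball (0 : Rn n) 1, singularWeight (1 + t) ‖ξ‖ ≤ C * weightDTilde n t ^ 2) :
    LowFrequencyBound n a κ γ 2 0 (weightDTilde n) := by
  obtain ⟨C, hC, hK⟩ := kernel_two_sq_low ha hκ hγ
  obtain ⟨D, hD, hw⟩ := h
  have hnn : ∀ t y, 0 ≤ singularWeight t y := fun t y => by unfold singularWeight; positivity
  refine ⟨√(C * D), by positivity, fun t ht => ⟨fun ξ => C * (Metric.ball (0 : Rn n) 1).indicator
    (fun ξ => singularWeight (1 + t) ‖ξ‖) ξ, ?_, fun ξ => ?_, fun ξ hξ hξ1 => ?_, ?_⟩⟩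
  · exact (((integrable_indicator_iff measurableSet_ball).2 (hw t ht).1)).const_mul C
  · exact mul_nonneg hC.le (Set.indicator_nonneg (fun _ _ => hnn _ _) _)
  · have hπ : 1 < 2 * π := by linarith [Real.pi_gt_three]
    have hlt : ‖ξ‖ < 2 * π * ‖ξ‖ := lt_mul_of_one_lt_left hξ hπ
    have hmem : ξ ∈ Metric.ball (0 : Rn n) 1 := by simpa using hlt.trans_le hξ1
    simp only [Set.indicator_of_mem hmem, pow_zero, one_mul]
    exact hK _ _ t hξ hlt.le hξ1 ht
  · rw [integral_const_mul, integral_indicator measurableSet_ball, mul_pow,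
      Real.sq_sqrt (by positivity), mul_assoc]
    exact mul_le_mul_of_nonneg_left (hw t ht).2 hC.le

/-- The square of the norm of the Fourier transform of the solution is integrated term by term. -/
theorem normL2_fourierSol_le {n : ℕ} (hn : 1 ≤ n) (ha : 0 < a) (hκ : 0 < κ) (hγ : 1 < γ)
    {α β : Fin 3 → ℝ → ℝ} (hα0 : ∀ j t, 0 ≤ t → 0 ≤ α j t) (hβ0 : ∀ j t, 0 ≤ t → 0 ≤ β j t)
    (hα : ∀ j, LowFrequencyBound n a κ γ j 0 (α j))
    (hβ : ∀ j, LowFrequencyBound n a κ γ j 1 (β j))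
    (hβe : ∀ j, ∀ c : ℝ, 0 < c → ∃ C : ℝ, 0 < C ∧ ∀ t, 0 ≤ t → Real.exp (-c * t) ≤ C * β j t) :
    ∃ C : ℝ, 0 < C ∧ ∀ ψ : Fin 3 → Rn n → ℂ, (∀ j, MemData (ψ j)) → ∀ t, 0 ≤ t →
      normL2 (fourierSol a κ γ (fun j => 𝓕 (ψ j)) 0 t)
        ≤ C * ∑ j, (β j t * dataNorm (ψ j) + α j t * ‖mean (ψ j)‖) := by
  have : Nonempty (Fin n) := ⟨⟨0, hn⟩⟩
  obtain ⟨c, C, hc, hC, hK⟩ := kernel_sq_high ha hκ hγ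
  choose Dα hDα Hα using hα
  choose Dβ hDβ Hβ using hβ
  choose De hDe He using fun j => hβe j c hc
  refine ⟨3 * ∑ j, (Dα j + Dβ j + C * De j), by
    have : ∀ j, 0 < Dα j + Dβ j + C * De j := fun j => by
      have := hDα j; have := hDβ j; have := hDe j; positivity
    have := Finset.sum_pos (fun j _ => this j) (Finset.univ_nonempty (α := Fin 3))
    positivity, fun ψ hψ t ht => ?_⟩
  choose gα iα pα bα Iα using fun j => Hα j t ht
  choose gβ iβ pβ bβ Iβ using fun j => Hβ j t ht
  set f : Fin 3 → Rn n → ℂ := fun j => 𝓕 (ψ j) with hf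
  have hf2 : ∀ j, MemLp (f j) 2 volume := fun j => memLp_fourier (hψ j).integrable (hψ j).memL2
  set N := fun j => normL11 (ψ j) with hN
  have hN0 : ∀ j, 0 ≤ N j := fun j => integral_nonneg fun x => by positivity
  set P := fun j => ‖mean (ψ j)‖ with hP
  set e := C ^ 2 * Real.exp (-c * t) ^ 2 with he
  have he0 : 0 ≤ e := by positivity
  -- The majorant of the square of the norm.
  set G : Rn n → ℝ := fun ξ =>
    6 * ∑ j, (gα j ξ * P j ^ 2 + gβ j ξ * N j ^ 2 + e * ‖f j ξ‖ ^ 2) with hG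
  have hpt : ∀ ξ : Rn n, 0 < ‖ξ‖ → ‖fourierSol a κ γ f 0 t ξ‖ ^ 2 ≤ G ξ := by
    intro ξ hξ
    set r := 2 * π * ‖ξ‖ with hr
    have hr0 : 0 < r := by positivity
    have hsum : ‖fourierSol a κ γ f 0 t ξ‖ ≤ ∑ j, |kernel a κ γ 0 j t r| * ‖f j ξ‖ := by
      unfold fourierSol
      refine (norm_sum_le _ _).trans (Finset.sum_le_sum fun j _ => ?_)
      rw [norm_mul, Complex.norm_real, Real.norm_eq_abs]
    have hcs : ‖fourierSol a κ γ f 0 t ξ‖ ^ 2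
        ≤ 3 * ∑ j, (kernel a κ γ 0 j t r) ^ 2 * ‖f j ξ‖ ^ 2 := by
      have h1 := sq_sum_le_card_mul_sum_sq (s := (Finset.univ : Finset (Fin 3)))
        (f := fun j => |kernel a κ γ 0 j t r| * ‖f j ξ‖)
      simp only [Finset.card_univ, Fintype.card_fin, mul_pow, sq_abs] at h1
      refine le_trans ?_ h1
      gcongr
    refine hcs.trans ?_
    simp only [hG]
    rw [show (6 : ℝ) = 3 * 2 by norm_num, mul_assoc, Finset.mul_sum Finset.univ _ (2 : ℝ)]
    refine mul_le_mul_of_nonneg_left (Finset.sum_le_sum fun j _ => ?_) (by norm_num)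
    have n1 : 0 ≤ gα j ξ * P j ^ 2 := mul_nonneg (pα j ξ) (sq_nonneg _)
    have n2 : 0 ≤ gβ j ξ * N j ^ 2 := mul_nonneg (pβ j ξ) (sq_nonneg _)
    have n3 : 0 ≤ e * ‖f j ξ‖ ^ 2 := by positivity
    rcases le_total r 1 with hr1 | hr1
    · have h1 : ‖f j ξ‖ ≤ P j + r * N j := by
        have h2 := norm_fourier_sub_mean_le (hψ j) ξ
        have h3 := norm_add_le (f j ξ - mean (ψ j)) (mean (ψ j))
        rw [sub_add_cancel] at h3
        linarith
      have h2 : ‖f j ξ‖ ^ 2 ≤ 2 * (P j ^ 2 + (r * N j) ^ 2) := by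
        calc _ ≤ (P j + r * N j) ^ 2 := by gcongr
          _ ≤ _ := by nlinarith [sq_nonneg (P j - r * N j)]
      have h3 := bα j ξ hξ hr1
      have h4 := bβ j ξ hξ hr1
      rw [pow_zero, one_mul] at h3
      rw [pow_one, mul_pow] at h4
      have h5 := mul_le_mul_of_nonneg_right h3 (sq_nonneg (P j))
      have h6 := mul_le_mul_of_nonneg_right h4 (sq_nonneg (N j))
      calc _ ≤ kernel a κ γ 0 j t r ^ 2 * (2 * (P j ^ 2 + (r * N j) ^ 2)) := by gcongr
        _ = 2 * (kernel a κ γ 0 j t r ^ 2 * P j ^ 2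
            + r ^ 2 * kernel a κ γ 0 j t r ^ 2 * N j ^ 2) := by ring
        _ ≤ _ := by linarith
    · have h1 := mul_le_mul_of_nonneg_right (hK j r t hr1 ht) (sq_nonneg ‖f j ξ‖)
      linarith
  have hGi : Integrable G := by
    refine (integrable_finsetSum _ fun j _ => ?_).const_mul 6
    exact (((iα j).mul_const _).add ((iβ j).mul_const _)).add
      (((hf2 j).integrable_norm_pow (by norm_num)).const_mul e)
  have hGint : ∫ ξ, G ξ = 6 * ∑ j, ((∫ ξ, gα j ξ) * P j ^ 2 + (∫ ξ, gβ j ξ) * N j ^ 2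
      + e * normL2 (ψ j) ^ 2) := by
    rw [hG, integral_const_mul, integral_finsetSum]
    · congr 1
      refine Finset.sum_congr rfl fun j _ => ?_
      have i3 := ((hf2 j).integrable_norm_pow (p := 2) (by norm_num)).const_mul e
      have hnorm : normL2 (ψ j) ^ 2 = ∫ ξ, ‖f j ξ‖ ^ 2 := by
        rw [← normL2_sq (hf2 j), normL2, normL2,
          eLpNorm_fourier (hψ j).integrable (hψ j).memL2]
      rw [hnorm, ← integral_mul_const, ← integral_mul_const, ← integral_const_mul,
        ← integral_add ((iα j).mul_const _) ((iβ j).mul_const _)]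
      exact integral_add (((iα j).mul_const _).add ((iβ j).mul_const _)) i3
    · exact fun j _ => (((iα j).mul_const _).add ((iβ j).mul_const _)).add
        (((hf2 j).integrable_norm_pow (by norm_num)).const_mul e)
  have hM : normL2 (fourierSol a κ γ f 0 t) ^ 2 ≤ ∫ ξ, G ξ := by
    rw [normL2_sq (memLp_fourierSol ha hκ hγ hf2 ht)]
    refine integral_mono_ae ((memLp_fourierSol ha hκ hγ hf2 ht).integrable_norm_pow (by norm_num))
      hGi ?_
    -- The low frequency bounds are singular at the origin, which is a null set because n ≥ 1.
    have : ∀ᵐ ξ : Rn n, ξ ≠ 0 := by simp [ae_iff]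
    filter_upwards [this] with ξ hξ using hpt ξ (norm_pos_iff.2 hξ)
  set S := ∑ j, (Dα j + Dβ j + C * De j) with hS
  have hterm : ∀ j, Dα j + Dβ j + C * De j ≤ S := fun j =>
    Finset.single_le_sum (f := fun j => Dα j + Dβ j + C * De j) (fun j _ => by
      have := hDα j; have := hDβ j; have := hDe j; positivity) (Finset.mem_univ j)
  set X : Fin 3 → ℝ := fun j => β j t * dataNorm (ψ j) + α j t * P j with hX
  have hd0 : ∀ j, 0 ≤ normL2 (ψ j) := fun j => ENNReal.toReal_nonneg
  have hX0 : ∀ j, 0 ≤ X j := fun j => add_nonneg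
    (mul_nonneg (hβ0 j t ht) (add_nonneg (hd0 j) (hN0 j)))
    (mul_nonneg (hα0 j t ht) (norm_nonneg _))
  have hj : ∀ j, (∫ ξ, gα j ξ) * P j ^ 2 + (∫ ξ, gβ j ξ) * N j ^ 2
      + e * normL2 (ψ j) ^ 2 ≤ (S * X j) ^ 2 := by
    intro j
    have q1 := hDα j
    have q2 := hDβ j
    have q3 := hDe j
    have a0 := hα0 j t ht
    have b0 := hβ0 j t ht
    have x1 : 0 ≤ Dα j * α j t * P j := by positivity
    have x2 : 0 ≤ Dβ j * β j t * N j := by have := hN0 j; positivity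
    have x3 : 0 ≤ C * (De j * β j t) * normL2 (ψ j) := by have := hd0 j; positivity
    have t1 : (∫ ξ, gα j ξ) * P j ^ 2 ≤ (Dα j * α j t * P j) ^ 2 := by
      rw [mul_pow _ (P j)]; gcongr; exact Iα j
    have t2 : (∫ ξ, gβ j ξ) * N j ^ 2 ≤ (Dβ j * β j t * N j) ^ 2 := by
      rw [mul_pow _ (N j)]; gcongr; exact Iβ j
    have t3 : e * normL2 (ψ j) ^ 2 ≤ (C * (De j * β j t) * normL2 (ψ j)) ^ 2 := by
      rw [mul_pow _ (normL2 (ψ j)), mul_pow C]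
      gcongr
      exact mul_le_mul_of_nonneg_left (by have := He j t ht; gcongr) (sq_nonneg C)
    have t4 : Dα j * α j t * P j + Dβ j * β j t * N j + C * (De j * β j t) * normL2 (ψ j)
        ≤ S * X j := by
      have y1 : 0 ≤ α j t * P j := by positivity
      have y2 : 0 ≤ β j t * N j := mul_nonneg b0 (hN0 j)
      have y3 : 0 ≤ β j t * normL2 (ψ j) := mul_nonneg b0 (hd0 j)
      have q4 : 0 < C * De j := by positivity
      have s1 : Dα j * (α j t * P j) ≤ S * (α j t * P j) := by
        gcongr; linarith [hterm j]
      have s2 : Dβ j * (β j t * N j) ≤ S * (β j t * N j) := by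
        gcongr; linarith [hterm j]
      have s3 : C * De j * (β j t * normL2 (ψ j)) ≤ S * (β j t * normL2 (ψ j)) := by
        gcongr; linarith [hterm j]
      have : S * X j = S * (α j t * P j) + S * (β j t * N j) + S * (β j t * normL2 (ψ j)) := by
        simp only [hX, dataNorm, hN]; ring
      rw [this]
      linarith
    calc _ ≤ (Dα j * α j t * P j) ^ 2 + (Dβ j * β j t * N j) ^ 2
          + (C * (De j * β j t) * normL2 (ψ j)) ^ 2 := by linarith
      _ ≤ (Dα j * α j t * P j + Dβ j * β j t * N j
          + C * (De j * β j t) * normL2 (ψ j)) ^ 2 := by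
        have z1 := mul_nonneg x1 x2
        have z2 := mul_nonneg x1 x3
        have z3 := mul_nonneg x2 x3
        linarith
      _ ≤ _ := by gcongr
  have hS0 : 0 ≤ S := Finset.sum_nonneg fun j _ => by
    have := hDα j; have := hDβ j; have := hDe j; positivity
  have hsumX : 0 ≤ ∑ j, X j := Finset.sum_nonneg fun j _ => hX0 j
  refine (abs_le_of_sq_le_sq' ?_ (by positivity)).2
  refine hM.trans ?_
  rw [hGint]
  calc _ ≤ 6 * ∑ j, (S * X j) ^ 2 := by gcongr with j _; exact hj j
    _ ≤ 6 * (∑ j, S * X j) ^ 2 := by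
      gcongr
      exact Finset.sum_sq_le_sq_sum_of_nonneg fun j _ => mul_nonneg hS0 (hX0 j)
    _ = 6 * (S * ∑ j, X j) ^ 2 := by rw [Finset.mul_sum]
    -- Here 6 ≤ 3².
    _ ≤ (3 * S * ∑ j, X j) ^ 2 := by nlinarith [sq_nonneg (S * ∑ j, X j)]

end

end Blackstock

/-! ### The main theorem -/

theorem mainTheorem7 (n : ℕ) (hn : 3 ≤ n) (b ν κ γ : ℝ) (hb : 0 < b) (hν : 0 < ν)
    (hκ : 0 < κ) (hγ : 1 < γ) (hγ' : γ ≤ 5 / 3) :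
    ∃ C : ℝ, 0 < C ∧ ∀ ψ₀ ψ₁ ψ₂ : Blackstock.Rn n → ℂ,
      Blackstock.MemData ψ₀ → Blackstock.MemData ψ₁ → Blackstock.MemData ψ₂ →
      ∃ ψ : ℝ → Lp ℂ 2 (volume : Measure (Blackstock.Rn n)),
        Blackstock.IsSolution b ν κ γ ψ₀ ψ₁ ψ₂ ψ ∧
        (∀ χ : ℝ → Lp ℂ 2 (volume : Measure (Blackstock.Rn n)),
          Blackstock.IsSolution b ν κ γ ψ₀ ψ₁ ψ₂ χ → ∀ t : ℝ, 0 ≤ t → χ t = ψ t) ∧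
        ∀ t : ℝ, 0 ≤ t →
          ‖ψ t‖ ≤ C *
            ((1 + t) ^ (-((n : ℝ) + 2) / 4) * Blackstock.dataNorm ψ₀
              + (1 + t) ^ (-(n : ℝ) / 4) * Blackstock.dataNorm ψ₁
              + Blackstock.weightD n t * Blackstock.dataNorm ψ₂
              + (1 + t) ^ (-(n : ℝ) / 4) * ‖Blackstock.mean ψ₀‖
              + Blackstock.weightD n t * ‖Blackstock.mean ψ₁‖
              + Blackstock.weightDTilde n t * ‖Blackstock.mean ψ₂‖) := by
  have ha : 0 < b * ν := mul_pos hb hν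
  have hn3 : (3 : ℝ) ≤ n := by exact_mod_cast hn
  have hn1 : 1 ≤ n := by omega
  have hD : Blackstock.weightD n = fun t => (1 + t) ^ (-((n : ℝ) / 4 - 1 / 2)) := by
    ext t
    rw [Blackstock.weightD, if_neg (by omega), if_neg (by omega)]
    congr 1
    ring
  -- The moment of order -4 converges only for n ≥ 5; dimensions three and four need the singular
  -- weight.
  have hα2 : Blackstock.LowFrequencyBound n (b * ν) κ γ 2 0 (Blackstock.weightDTilde n) := by
    rcases (show n = 3 ∨ n = 4 ∨ 5 ≤ n by omega) with rfl | rfl | h5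
    · exact Blackstock.lowFrequencyBound_singular ha hκ hγ Blackstock.singularWeight_three
    · exact Blackstock.lowFrequencyBound_singular ha hκ hγ Blackstock.singularWeight_four
    · have hn5 : (5 : ℝ) ≤ n := by exact_mod_cast h5
      have hw : Blackstock.weightDTilde n = fun t => (1 + t) ^ (-((n : ℝ) / 4 - 1)) := by
        ext t
        rw [Blackstock.weightDTilde, if_neg (by omega), if_neg (by omega)]
        congr 1
        ring
      rw [hw]
      exact Blackstock.lowFrequencyBound_of_lt hn1 ha hκ hγ 2 0 (by linarith)
        (by norm_num; ring)
  have hα2_nonneg : ∀ t, 0 ≤ t → 0 ≤ Blackstock.weightDTilde n t := fun t ht => by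
    have : 0 ≤ Real.log (Real.exp 1 + t) :=
      Real.log_nonneg (by linarith [Real.add_one_le_exp (1 : ℝ)])
    unfold Blackstock.weightDTilde
    split_ifs <;> positivity
  -- These are (n + 2 - 2j)/4, the exponents for r K_j; the last is positive because n ≥ 3.
  set s : Fin 3 → ℝ := ![((n : ℝ) + 2) / 4, (n : ℝ) / 4, (n : ℝ) / 4 - 1 / 2] with hs
  have hs0 : ∀ j, 0 < s j := fun j => by
    fin_cases j <;> simp [hs] <;> linarith
  obtain ⟨C, hC, h⟩ := Blackstock.normL2_fourierSol_le (n := n) hn1 ha hκ hγ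
    (α := ![fun t => (1 + t) ^ (-((n : ℝ) / 4)), fun t => (1 + t) ^ (-((n : ℝ) / 4 - 1 / 2)),
      Blackstock.weightDTilde n])
    (β := fun j t => (1 + t) ^ (-s j))
    (fun j t ht => by
      fin_cases j
      · exact Real.rpow_nonneg (by linarith) _
      · exact Real.rpow_nonneg (by linarith) _
      · exact hα2_nonneg t ht)
    (fun j t ht => Real.rpow_nonneg (by linarith) _)
    (fun j => by
      fin_cases j
      · exact Blackstock.lowFrequencyBound_of_lt hn1 ha hκ hγ 0 0 (by linarith)
          (by norm_num; ring)
      · exact Blackstock.lowFrequencyBound_of_lt hn1 ha hκ hγ 1 0 (by linarith)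
          (by norm_num; ring)
      · exact hα2)
    (fun j => Blackstock.lowFrequencyBound_of_lt hn1 ha hκ hγ j 1 (hs0 j) (by
      fin_cases j <;> simp [hs] <;> ring))
    (fun j c hc => Blackstock.exp_neg_le_rpow hc (hs0 j))
  refine ⟨C, hC, fun ψ₀ ψ₁ ψ₂ h₀ h₁ h₂ => ?_⟩
  set ψ : Fin 3 → Blackstock.Rn n → ℂ := ![ψ₀, ψ₁, ψ₂] with hψ
  have hdata : ∀ j, Blackstock.MemData (ψ j) := fun j => by
    fin_cases j
    · exact h₀
    · exact h₁
    · exact h₂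
  have hf := fun j => Blackstock.memLp_fourier (hdata j).integrable (hdata j).memL2
  have hsol := Blackstock.isSolution_solution ha hκ hγ hdata hf
  refine ⟨Blackstock.solution ha hκ hγ hf, hsol, fun χ hχ t ht => hχ.eq hsol ht,
    fun t ht => ?_⟩
  rw [Blackstock.norm_solution ha hκ hγ hf ht]
  refine (h ψ hdata t ht).trans (le_of_eq ?_)
  rw [Fin.sum_univ_three, hD]
  simp only [hs, hψ, Matrix.cons_val_zero, Matrix.cons_val_one, Matrix.cons_val, neg_div]
  ring
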